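/- **Theorem (convergence of TT-NAC).** Let $S$ be a countable state space, $A$ a finite action space, $P(\cdot\mid s,a)$ a transition kernel, $r:S\times A\to\mathbb R$ a reward, $\rho_0$ an initial state distribution and $\gamma\in[0,1)$. Let $X$ be the set of all stationary policies $\pi(\cdot\mid s)$, and put $P^\pi(s'\mid s)=\sum_a\pi(a\mid s)P(s'\mid s,a)$ and $(P^\pi f)(s,a)=\sum_{s'}P(s'\mid s,a)\sum_{a'}\pi(a'\mid s')f(s',a')$. Let $Q^\pi(s,a)=\mathbb E_\pi[\sum_{t\ge0}\gamma^t r(s_t,a_t)\mid s_0=s,a_0=a]$. Let $\rho^\pi(s)=(1-\gamma)\sum_{t\ge0}\gamma^t\,\mathbb P(s_t=s)$ be the visitation measure of $\pi$ with $s_0\sim\rho_0$, and let $\varrho(s,a,\pi)$ be the measure given by the same formula when the chain starts from $(s_0,a_0)=(s,a)$ and follows $\pi$ afterwards. For $f,g:S\times A\to\mathbb R$ and a measure $\rho$ on $S$ write $\langle f,g\rangle_\rho=\sum_s\rho(s)\sum_a f(s,a)g(s,a)$, and let $\bar D_\rho(\pi,\pi')=\sum_s\rho(s)\,D_{\mathrm{KL}}(\pi(\cdot\mid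 s)\,\|\,\pi'(\cdot\mid s))\in[0,\infty]$. Let $\phi:S\times A\to\mathbb R^d$ be a feature map and $Q_\theta(s,a)=\phi(s,a)^\top\theta$. Let $\bar r,\mu_\phi,C_\rho>0$ and assume: 1. $|r(s,a)|\le\bar r$ for all $(s,a)$. 2. $\|\phi(s,a)\|_2\le1$ for all $(s,a)$, and for every $\pi\in X$ there is $\theta$ with $Q^\pi=Q_\theta$. 3. For every $\pi\in X$ the chain $P^\pi$ has a unique stationary distribution $\mu^\pi$, and $\mathbb E_{s\sim\mu^\pi,a\sim\pi(\cdot\mid s)}[\phi(s,a)\phi(s,a)^\top]\succeq\mu_\phi^2I_d$. 4. $\pi^\star\in X$ is a minimizer over $X$ of $\ell(\pi)=-\langle Q_{\theta^\star(\pi)},\pi\rangle_{\rho_0}$, where $$\theta^\star(\pi)\in\arg\min_{\theta\in\mathbb R^d}\tfrac12\sum_{s}\mu^\pi(s)\sum_a\pi(a\mid s)\big[Q_\theta(s,a)-r(s,a)-\gamma(P^\pi Q_\theta)(s,a)\big]^2 .$$ With $\rho^\star=\rho^{\pi^\star}$, for all $(s,a)$ and all $\pi\in X$ the measure $\varrho(s,a,\pi)$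 is absolutely continuous with respect to $\rho^\star$, and $\mathbb E_{s'\sim\rho^\star}\big[\big(\tfrac{\varrho(s,a,\pi)(s')}{\rho^\star(s')}\big)^2\big]\le C_\rho^2$. For an integer $K\ge32^2$ set $$\alpha=\frac{(1-\gamma)^3\mu_\phi}{\sqrt{\bar r\,C_\rho^2}}\min\Big\{\frac{(1-\gamma)^2}{128\mu_\phi^{-2}},K^{-3/4}\Big\},\qquad \beta=\min\Big\{\frac{(1-\gamma)\mu_\phi^2}{8},\frac{16}{(1-\gamma)\mu_\phi^2}K^{-1/2}\Big\}.$$ From deterministic $\theta^0\in\mathbb R^d$, $\pi^0\in X$, the TT-NAC algorithm iterates, for $k=0,\dots,K-1$: conditionally on the past draw $s\sim\mu^{\pi^k}$, $a\sim\pi^k(\cdot\mid s)$, $s'\sim P(\cdot\mid s,a)$, $a'\sim\pi^k(\cdot\mid s')$, and put $$\theta^{k+1}=\theta^k-\beta\,[\phi(s,a)^\top\theta^k-r(s,a)-\gamma\phi(s',a')^\top\theta^k]\,\phi(s,a),$$ $$\pi^{k+1}\in\arg\min_{\pi\in X}\Big\{-(1-\gamma)^{-1}\langle Q_{\theta^{k+1}},\pi-\pi^k\rangle_{\rho^{\pi^k}}+\tfrac1\alpha\bar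 D_{\rho^{\pi^k}}(\pi,\pi^k)\Big\}.$$ Suppose $\|\theta^0-\theta^\star(\pi^0)\|_2\le B$ and $\bar D_{\rho^\star}(\pi^\star,\pi^0)\le B$ for some finite $B$. Let $\mathsf K$ be uniformly distributed on $\{0,\dots,K-1\}$ and independent of the samples drawn by the algorithm. Then there is a constant $C$, depending only on $\gamma,\bar r,\mu_\phi,C_\rho,B$ (and not on $K$), such that the two random variables below are integrable and $$\mathbb E[\ell(\pi^{\mathsf K})-\ell(\pi^\star)]\le C\,K^{-1/4},\qquad \mathbb E\big[\|\theta^{\mathsf K+1}-\theta^\star(\pi^{\mathsf K})\|_2^2\big]\le C\,K^{-1/2}.$$ -/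

import Mathlib

open MeasureTheory ProbabilityTheory

open scoped ENNReal

noncomputable section

/-- Markov decision process with state space `S` and action space `A`: transition kernel `P`,
reward `r` and initial state distribution `ρ₀`.  The discount factor is passed separately. -/
structure MDP (S A : Type*) where
  P : S → A → PMF S
  r : S → A → ℝ
  ρ₀ : PMF S

/-- Stationary policies: `π s a` is the probability of action `a` in state `s`. -/
abbrev Policy (S A : Type*) := S → PMF A

/-- A policy as a real function on `S × A`. -/
def Policy.prob {S A : Type*} (π : Policy S A) : S → A → ℝ := fun s a => (π s a).toReal

namespace MDP

variable {S A : Type*} [Fintype A]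

/-- The state transition kernel `P^π(s' | s) = ∑ₐ π(a | s) P(s' | s, a)`. -/
def transition (M : MDP S A) (π : Policy S A) (s : S) : PMF S := (π s).bind (M.P s)

/-- `ν` is a stationary distribution of the chain `P^π`. -/
def IsStationary (M : MDP S A) (π : Policy S A) (ν : PMF S) : Prop :=
  ν.bind (M.transition π) = ν

/-- The law of `s_t` when `s_0 ∼ ν` and actions follow `π`. -/
def stateLaw (M : MDP S A) (π : Policy S A) (ν : PMF S) : ℕ → PMF S
  | 0 => ν
  | t + 1 => (stateLaw M π ν t).bind (M.transition π)

/-- The law of `s_t` when `(s_0, a_0) = (s, a)` and later actions follow `π`. -/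
def stateLawFrom (M : MDP S A) (π : Policy S A) (s : S) (a : A) : ℕ → PMF S
  | 0 => PMF.pure s
  | t + 1 => M.stateLaw π (M.P s a) t

/-- The visitation measure `ρ^π` with `s_0 ∼ ρ₀`, normalized to a probability. -/
def visitation (M : MDP S A) (γ : ℝ) (π : Policy S A) (s : S) : ℝ :=
  (1 - γ) * ∑' t : ℕ, γ ^ t * (M.stateLaw π M.ρ₀ t s).toReal

/-- The visitation measure `ϱ(s, a, π)`, normalized to a probability. -/
def visitationFrom (M : MDP S A) (γ : ℝ) (s : S) (a : A) (π : Policy S A) (s' : S) : ℝ :=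
  (1 - γ) * ∑' t : ℕ, γ ^ t * (M.stateLawFrom π s a t s').toReal

/-- The Markov operator
`(P^π f)(s, a) = ∑_{s'} P(s' | s, a) ∑_{a'} π(a' | s') f(s', a')`. -/
def markovOp (M : MDP S A) (π : Policy S A) (f : S → A → ℝ) : S → A → ℝ :=
  fun s a => ∑' s', (M.P s a s').toReal * ∑ a', π.prob s' a' * f s' a'

/-- The action-value function
`Q^π(s, a) = ∑ₜ γᵗ E_π[r(s_t, a_t) | s_0 = s, a_0 = a]`. -/
def qValue (M : MDP S A) (γ : ℝ) (π : Policy S A) (s : S) (a : A) : ℝ :=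
  ∑' t : ℕ, γ ^ t * ((M.markovOp π)^[t] M.r) s a

end MDP

section Algorithm

variable {S A : Type*} [Fintype A] {d : ℕ}

/-- The linear action-value function `Q_θ(s, a) = φ(s, a)ᵀ θ`. -/
def linQ (φ : S → A → EuclideanSpace ℝ (Fin d)) (θ : EuclideanSpace ℝ (Fin d)) : S → A → ℝ :=
  fun s a => inner ℝ (φ s a) θ

/-- `⟨f, g⟩_ρ = ∑ₛ ⟨f(s, ·), g(s, ·)⟩ ρ(s)`. -/
def pairing (ρ : S → ℝ) (f g : S → A → ℝ) : ℝ := ∑' s, (∑ a, f s a * g s a) * ρ s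

/-- The squared norm `‖f‖²_{ν ⊗ π}`. -/
def sqNorm (ν : PMF S) (π : Policy S A) (f : S → A → ℝ) : ℝ :=
  ∑' s, (∑ a, π.prob s a * f s a ^ 2) * (ν s).toReal

/-- The inner objective: half the mean squared Bellman error of `Q_θ` under `ν ⊗ π`. -/
def msbe (M : MDP S A) (γ : ℝ) (φ : S → A → EuclideanSpace ℝ (Fin d)) (ν : PMF S)
    (π : Policy S A) (θ : EuclideanSpace ℝ (Fin d)) : ℝ :=
  1 / 2 * sqNorm ν π (fun s a => linQ φ θ s a - M.r s a - γ * M.markovOp π (linQ φ θ) s a)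

/-- The outer objective `ℓ(π) = -⟨Q_{θ⋆(π)}, π⟩_{ρ₀}`. -/
def outerLoss (M : MDP S A) (φ : S → A → EuclideanSpace ℝ (Fin d))
    (θstar : Policy S A → EuclideanSpace ℝ (Fin d)) (π : Policy S A) : ℝ :=
  -pairing (fun s => (M.ρ₀ s).toReal) (linQ φ (θstar π)) π.prob

/-- The feature covariance `E_{s ∼ ν, a ∼ π(· | s)}[φ(s, a) φ(s, a)ᵀ]`. -/
def featureCov (φ : S → A → EuclideanSpace ℝ (Fin d)) (ν : PMF S) (π : Policy S A) :
    Matrix (Fin d) (Fin d) ℝ :=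
  Matrix.of fun i j => ∑' s, (∑ a, π.prob s a * (φ s a i * φ s a j)) * (ν s).toReal

/-- Concentrability with constant `Cρ` relative to `ρ⋆ = ρ^{π⋆}`: every `ϱ(s, a, π)` has a density
with respect to `ρ⋆`, whose second moment under `ρ⋆` is at most `Cρ²`. -/
def Concentrability (M : MDP S A) (γ : ℝ) (πstar : Policy S A) (Cρ : ℝ) : Prop :=
  ∀ (s : S) (a : A) (π : Policy S A),
    (∀ s', M.visitation γ πstar s' = 0 → M.visitationFrom γ s a π s' = 0) ∧
    ∑' s', ENNReal.ofReal (M.visitation γ πstar s' *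
      (M.visitationFrom γ s a π s' / M.visitation γ πstar s') ^ 2) ≤ ENNReal.ofReal (Cρ ^ 2)

variable [MeasurableSpace A]

/-- The averaged Kullback–Leibler divergence
`D̄_{ψ,ρ}(π, π') = ∑ₛ D_KL(π(· | s) ‖ π'(· | s)) ρ(s)`, possibly infinite. -/
def klBar (ρ : S → ℝ) (π π' : Policy S A) : ℝ≥0∞ :=
  ∑' s, InformationTheory.klDiv (π s).toMeasure (π' s).toMeasure * ENNReal.ofReal (ρ s)

/-- The objective of the actor's mirror descent step at the policy `πk` with critic `θ`. -/
def actorObjective (M : MDP S A) (γ : ℝ) (φ : S → A → EuclideanSpace ℝ (Fin d)) (α : ℝ)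
    (θ : EuclideanSpace ℝ (Fin d)) (πk π : Policy S A) : EReal :=
  ((-(1 - γ)⁻¹ * pairing (M.visitation γ πk) (linQ φ θ) (π.prob - πk.prob) : ℝ) : EReal) +
    ((ENNReal.ofReal (1 / α) * klBar (M.visitation γ πk) π πk : ℝ≥0∞) : EReal)

/-- The stochastic TD(0) semigradient at the sample `(s, a, s', a')`. -/
def tdDirection (M : MDP S A) (γ : ℝ) (φ : S → A → EuclideanSpace ℝ (Fin d))
    (θ : EuclideanSpace ℝ (Fin d)) (z : S × A × S × A) : EuclideanSpace ℝ (Fin d) :=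
  (linQ φ θ z.1 z.2.1 - M.r z.1 z.2.1 - γ * linQ φ θ z.2.2.1 z.2.2.2) • φ z.1 z.2.1

/-- The probability of `(s, a, s', a')` when `s ∼ ν`, `a ∼ π(· | s)`, `s' ∼ P(· | s, a)`,
`a' ∼ π(· | s')`. -/
def sampleProb (M : MDP S A) (ν : PMF S) (π : Policy S A) (z : S × A × S × A) : ℝ :=
  (ν z.1).toReal * π.prob z.1 z.2.1 * (M.P z.1 z.2.1 z.2.2.1).toReal * π.prob z.2.2.1 z.2.2.2

variable [MeasurableSpace S]

/-- `(θ k, π k)` are the iterates, through iteration `K`, of the two-timescale natural actor-critic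
method with step sizes `α` (actor) and `β` (critic), started at `(θ₀, π₀)` and driven by the
samples `Z k`.  Here `μ π` is the stationary distribution used for sampling under `π`, and
`ℱ` is a filtration to which the iterates are adapted. -/
structure IsTTNAC (M : MDP S A) (γ : ℝ) (φ : S → A → EuclideanSpace ℝ (Fin d))
    (μ : Policy S A → PMF S) (α β : ℝ) (K : ℕ)
    (θ₀ : EuclideanSpace ℝ (Fin d)) (π₀ : Policy S A)
    {Ω : Type*} {mΩ : MeasurableSpace Ω} (Pr : Measure Ω) (ℱ : Filtration ℕ mΩ)
    (Z : ℕ → Ω → S × A × S × A) (θ : ℕ → Ω → EuclideanSpace ℝ (Fin d))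
    (π : ℕ → Ω → Policy S A) : Prop where
  measurable_sample : ∀ k < K, Measurable (Z k)
  adapted_critic : ∀ k ≤ K, Measurable[ℱ k] (θ k)
  adapted_actor : ∀ k ≤ K, ∀ s a, Measurable[ℱ k] (fun ω => (π k ω).prob s a)
  init_critic : ∀ ω, θ 0 ω = θ₀
  init_actor : ∀ ω, π 0 ω = π₀
  /-- Conditionally on the past, `Z k` is drawn from `μ^{π^k} ⊗ π^k ⊗ P ⊗ π^k`. -/
  sample_law : ∀ k < K, ∀ z : S × A × S × A,
    Pr⟦(Z k) ⁻¹' {z} | ℱ k⟧ =ᵐ[Pr] fun ω => sampleProb M (μ (π k ω)) (π k ω) z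
  critic_step : ∀ k < K, ∀ ω, θ (k + 1) ω = θ k ω - β • tdDirection M γ φ (θ k ω) (Z k ω)
  actor_step : ∀ k < K, ∀ ω,
    IsMinOn (actorObjective M γ φ α (θ (k + 1) ω) (π k ω)) Set.univ (π (k + 1) ω)

end Algorithm

/-- The actor step size for a horizon of `K` iterations. -/
def actorStep (γ rbar μφ Cρ : ℝ) (K : ℕ) : ℝ :=
  (1 - γ) ^ 3 * μφ / √(rbar * Cρ ^ 2) *
    min ((1 - γ) ^ 2 / (128 * (μφ ^ 2)⁻¹)) ((K : ℝ) ^ (-(3 / 4) : ℝ))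

/-- The critic step size for a horizon of `K` iterations. -/
def criticStep (γ μφ : ℝ) (K : ℕ) : ℝ :=
  min ((1 - γ) * μφ ^ 2 / 8) (16 / ((1 - γ) * μφ ^ 2) * (K : ℝ) ^ (-(1 / 2) : ℝ))

end

/-! Concentrability at the starting state, where the measure ϱ(s, a, π) has mass at least 1 - γ,
bounds ρ⋆ below by (1 - γ)²/Cρ² at every state. As ρ⋆ has total mass at most one, `S` is finite
(`MDP.finite_of_concentrability`). Finiteness only turns series into sums and gives random variables
finitely many values; no constant depends on the number of states.

Critic. Under the stationary law, f ↦ f - γ P^π f is strongly monotone in mean square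
(`MDP.IsStationary.mean_sq_le`). With realizability and the covariance bound this identifies θ⋆(π)
as the parameter of Q^π (`eq_of_isMinOn_msbe`), and makes an expected TD step contract the squared
distance to θ⋆(π) by the factor 1 - λ, λ = β(1 - γ)μφ², up to O(β²)
(`sum_sampleProb_sq_norm_critic_le`).

Actor. Finite initial divergence puts the support of π⋆ inside that of π⁰, and actor steps preserve
supports, so the visitation measure of every iterate charges every state. The actor's problem then
splits over states and has a single solution, the tilting of π^k by exp(η Q_θ) with η = α/(1 - γ)
(`eq_softmax_of_isMinOn`). The weights ρ^{π^k} have disappeared, so progress can be measured under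
the fixed ρ⋆: performance difference and Hoeffding's lemma bound η(1 - γ) times the optimality gap
by the decrease of the divergence from π⋆, plus O(η²‖θ‖²), plus 2η times the critic error
(`outerLoss_gap_le`). Meanwhile the critic's target moves by only O(η‖θ‖) (`norm_thetaStar_sub_le`).

Rates (`two_timescale_rates`). Put x = K^(-1/4), so that η is of order x³ and β, λ are of order x².
The noise β² and the drift η²/λ cost O(x⁴) = O(1/K) per step, hence O(1) in total, and the
contraction gives an average squared critic error O(x⁴/λ) = O(x²). Telescoping the divergence bounds
the average gap by O(x⁴/η + η + x) = O(x). -/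

namespace PMF

/-! ### Averages against probability mass functions. -/

variable {α β : Type*} [Fintype α]

theorem sum_toReal (p : PMF α) : ∑ a, (p a).toReal = 1 := by
  rw [← ENNReal.toReal_sum fun a _ => p.apply_ne_top a, ← ENNReal.toReal_one, ← p.tsum_coe, tsum_fintype]

theorem toReal_bind (p : PMF α) (f : α → PMF β) (b : β) :
    (p.bind f b).toReal = ∑ a, (p a).toReal * (f a b).toReal := by
  rw [PMF.bind_apply, tsum_fintype, ENNReal.toReal_sum]
  · simp
  · exact fun a _ => ENNReal.mul_ne_top (p.apply_ne_top a) ((f a).apply_ne_top b)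

theorem abs_sum_toReal_mul_le (p : PMF α) {f : α → ℝ} {m : ℝ} (hf : ∀ a, |f a| ≤ m) :
    |∑ a, (p a).toReal * f a| ≤ m := by
  calc |∑ a, (p a).toReal * f a| ≤ ∑ a, (p a).toReal * m := by
        refine (Finset.abs_sum_le_sum_abs _ _).trans (Finset.sum_le_sum fun a _ => ?_)
        rw [abs_mul, abs_of_nonneg ENNReal.toReal_nonneg]
        exact mul_le_mul_of_nonneg_left (hf a) ENNReal.toReal_nonneg
    _ = m := by rw [← Finset.sum_mul, p.sum_toReal, one_mul]

end PMF

theorem PMF.sum_finset_toReal_le_one {α : Type*} (p : PMF α) (F : Finset α) :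
    ∑ a ∈ F, (p a).toReal ≤ 1 := by
  rw [← ENNReal.toReal_sum fun a _ => p.apply_ne_top a, ← ENNReal.toReal_one]
  exact ENNReal.toReal_mono ENNReal.one_ne_top ((ENNReal.sum_le_tsum F).trans p.tsum_coe.le)

theorem PMF.toReal_le_one {α : Type*} (p : PMF α) (a : α) : (p a).toReal ≤ 1 := by
  simpa using p.sum_finset_toReal_le_one {a}

/-- A bounded solution of a discounted inequality is bounded by the geometric sum. -/
theorem abs_le_div_of_discounted {ι : Type*} [Finite ι] {γ b : ℝ} (hγ : γ < 1) {f : ι → ℝ}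
    (h : ∀ m, (∀ i, |f i| ≤ m) → ∀ i, |f i| ≤ b + γ * m) (i : ι) : |f i| ≤ b / (1 - γ) := by
  have : Nonempty ι := ⟨i⟩
  obtain ⟨j, hj⟩ := Finite.exists_max fun i => |f i|
  -- The maximum of `|f|` is itself an admissible `m`; at the maximizer this reads `m ≤ b + γ * m`.
  have := h _ hj j
  rw [le_div_iff₀ (by linarith)]
  nlinarith [hj i]

namespace Policy

variable {S A : Type*} (π : Policy S A)

theorem prob_nonneg (s : S) (a : A) : 0 ≤ π.prob s a := ENNReal.toReal_nonneg

theorem sum_prob [Fintype A] (s : S) : ∑ a, π.prob s a = 1 := (π s).sum_toReal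

theorem abs_sum_prob_mul_le [Fintype A] {f : S → A → ℝ} {m : ℝ} (hf : ∀ s a, |f s a| ≤ m)
    (s : S) : |∑ a, π.prob s a * f s a| ≤ m :=
  (π s).abs_sum_toReal_mul_le (hf s)

theorem prob_ext {π π' : Policy S A} (h : ∀ s a, π.prob s a = π'.prob s a) : π = π' := by
  funext s
  ext a
  exact (ENNReal.toReal_eq_toReal_iff' ((π s).apply_ne_top a) ((π' s).apply_ne_top a)).1 (h s a)

end Policy

namespace MDP

variable {S A : Type*} (M : MDP S A) {γ : ℝ}

/-! ### Visitation measures and finiteness of the state space. -/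

section Visitation

theorem summable_discounted (hγ0 : 0 ≤ γ) (hγ1 : γ < 1) {u : ℕ → ℝ} {b : ℝ}
    (hu : ∀ t, |u t| ≤ b) : Summable fun t => γ ^ t * u t := by
  refine Summable.of_norm_bounded (g := fun t => γ ^ t * b)
    ((summable_geometric_of_lt_one hγ0 hγ1).mul_right b) fun t => ?_
  rw [Real.norm_eq_abs, abs_mul, abs_of_nonneg (pow_nonneg hγ0 t)]
  exact mul_le_mul_of_nonneg_left (hu t) (pow_nonneg hγ0 t)

theorem abs_tsum_discounted_le (hγ0 : 0 ≤ γ) (hγ1 : γ < 1) {u : ℕ → ℝ} {b : ℝ}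
    (hu : ∀ t, |u t| ≤ b) : |∑' t, γ ^ t * u t| ≤ b / (1 - γ) := by
  have h := tsum_of_norm_bounded (f := fun t => γ ^ t * u t) (g := fun t => γ ^ t * b)
    (a := (1 - γ)⁻¹ * b) ((hasSum_geometric_of_lt_one hγ0 hγ1).mul_right b) fun t => by
      rw [Real.norm_eq_abs, abs_mul, abs_of_nonneg (pow_nonneg hγ0 t)]
      exact mul_le_mul_of_nonneg_left (hu t) (pow_nonneg hγ0 t)
  rwa [Real.norm_eq_abs, inv_mul_eq_div] at h

theorem tsum_discounted_succ (hγ0 : 0 ≤ γ) (hγ1 : γ < 1) {u : ℕ → ℝ} {b : ℝ}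
    (hu : ∀ t, |u t| ≤ b) :
    ∑' t, γ ^ t * u t = u 0 + γ * ∑' t, γ ^ t * u (t + 1) := by
  rw [(summable_discounted hγ0 hγ1 hu).tsum_eq_zero_add, ← tsum_mul_left]
  simp [pow_succ', mul_assoc]

theorem abs_toReal_le (p : ℕ → PMF S) (s : S) (t : ℕ) : |(p t s).toReal| ≤ 1 := by
  rw [abs_of_nonneg ENNReal.toReal_nonneg]
  exact (p t).toReal_le_one s

theorem summable_law (hγ0 : 0 ≤ γ) (hγ1 : γ < 1) (p : ℕ → PMF S) (s : S) :
    Summable fun t => γ ^ t * (p t s).toReal :=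
  summable_discounted hγ0 hγ1 (abs_toReal_le p s)

theorem visitation_nonneg (hγ0 : 0 ≤ γ) (hγ1 : γ < 1) (π : Policy S A) (s : S) :
    0 ≤ M.visitation γ π s :=
  mul_nonneg (by linarith) (tsum_nonneg fun t =>
    mul_nonneg (pow_nonneg hγ0 t) ENNReal.toReal_nonneg)

theorem sum_visitation_le_one (hγ0 : 0 ≤ γ) (hγ1 : γ < 1) (π : Policy S A) (F : Finset S) :
    ∑ s ∈ F, M.visitation γ π s ≤ 1 := by
  have h1 : (1 - γ) ≠ 0 := by linarith
  simp only [visitation, ← Finset.mul_sum]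
  rw [← Summable.tsum_finsetSum fun s _ => summable_law hγ0 hγ1 _ s]
  simp only [← Finset.mul_sum]
  have h2 := abs_tsum_discounted_le hγ0 hγ1 (b := 1)
    (u := fun t => ∑ s ∈ F, (M.stateLaw π M.ρ₀ t s).toReal) fun t => by
      rw [abs_of_nonneg (Finset.sum_nonneg fun _ _ => ENNReal.toReal_nonneg)]
      exact (M.stateLaw π M.ρ₀ t).sum_finset_toReal_le_one F
  calc _ ≤ (1 - γ) * (1 / (1 - γ)) :=
        mul_le_mul_of_nonneg_left (le_of_abs_le h2) (by linarith)
    _ = 1 := by field_simp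

/-- The term t = 0 is a point mass at `s` and already contributes 1 - γ. -/
theorem le_visitationFrom_self (hγ0 : 0 ≤ γ) (hγ1 : γ < 1) (π : Policy S A) (s : S) (a : A) :
    1 - γ ≤ M.visitationFrom γ s a π s := by
  have h := (summable_law hγ0 hγ1 (M.stateLawFrom π s a) s).le_tsum 0 fun t _ =>
    mul_nonneg (pow_nonneg hγ0 t) ENNReal.toReal_nonneg
  simp only [stateLawFrom, PMF.pure_apply, if_true, pow_zero, ENNReal.toReal_one,
    one_mul] at h
  calc 1 - γ = (1 - γ) * 1 := (mul_one _).symm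
    _ ≤ _ := mul_le_mul_of_nonneg_left h (by linarith)

/-- The visitation measure charges `s` as soon as some `s_t` with positive discount does. -/
theorem visitation_pos_iff (hγ0 : 0 ≤ γ) (hγ1 : γ < 1) (π : Policy S A) (s : S) :
    0 < M.visitation γ π s ↔ ∃ t, γ ^ t ≠ 0 ∧ M.stateLaw π M.ρ₀ t s ≠ 0 := by
  have h0 : ∀ t, 0 ≤ γ ^ t * (M.stateLaw π M.ρ₀ t s).toReal := fun t =>
    mul_nonneg (pow_nonneg hγ0 t) ENNReal.toReal_nonneg
  constructor
  · intro h
    by_contra! hc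
    refine h.ne' ?_
    simp only [visitation]
    rw [show (fun t => γ ^ t * (M.stateLaw π M.ρ₀ t s).toReal) = fun _ => 0 from ?_]
    · simp
    · funext t
      by_cases ht : γ ^ t = 0
      · simp [ht]
      · simp [hc t ht]
  · rintro ⟨t, ht, hs⟩
    refine mul_pos (by linarith) ((summable_law hγ0 hγ1 _ s).tsum_pos h0 t ?_)
    exact mul_pos ((pow_nonneg hγ0 t).lt_of_ne' ht)
      (ENNReal.toReal_pos hs ((M.stateLaw π M.ρ₀ t).apply_ne_top s))

theorem stateLaw_support_mono {π π' : Policy S A} (h : ∀ s a, π s a ≠ 0 → π' s a ≠ 0)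
    (ν : PMF S) (t : ℕ) (s : S) (hs : M.stateLaw π ν t s ≠ 0) : M.stateLaw π' ν t s ≠ 0 := by
  induction t generalizing s with
  | zero => exact hs
  | succ t ih =>
    simp only [stateLaw, transition, ← PMF.mem_support_iff, PMF.mem_support_bind_iff] at hs ⊢
    obtain ⟨s', hs', a, ha, hP⟩ := hs
    exact ⟨s', ih s' hs', a, h s' a ha, hP⟩

/-- A path possible under `π` stays possible under `π'`. This carries full support from ρ⋆ to the
visitation measures of the iterates. -/
theorem visitation_pos_mono (hγ0 : 0 ≤ γ) (hγ1 : γ < 1) {π π' : Policy S A}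
    (h : ∀ s a, π s a ≠ 0 → π' s a ≠ 0) {s : S} (hs : 0 < M.visitation γ π s) :
    0 < M.visitation γ π' s := by
  rw [visitation_pos_iff M hγ0 hγ1] at hs ⊢
  obtain ⟨t, ht, hs⟩ := hs
  exact ⟨t, ht, M.stateLaw_support_mono h _ t s hs⟩

/-- Concentrability bounds the reference visitation measure below. -/
theorem visitation_ge_of_concentrability (hγ0 : 0 ≤ γ) (hγ1 : γ < 1) {πstar : Policy S A}
    {C : ℝ} (h : Concentrability M γ πstar C) (s : S) :
    0 < M.visitation γ πstar s ∧ (1 - γ) ^ 2 ≤ C ^ 2 * M.visitation γ πstar s := by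
  obtain ⟨a, -⟩ := (πstar s).support_nonempty
  obtain ⟨h1, h2⟩ := h s a πstar
  have h3 := M.le_visitationFrom_self hγ0 hγ1 πstar s a
  have hpos : 0 < M.visitation γ πstar s := by
    refine (M.visitation_nonneg hγ0 hγ1 πstar s).lt_of_ne' fun h0 => ?_
    have := h1 s h0
    linarith
  refine ⟨hpos, ?_⟩
  have h4 := (ENNReal.le_tsum s).trans h2
  rw [ENNReal.ofReal_le_ofReal_iff (sq_nonneg C)] at h4
  have h5 : M.visitation γ πstar s *
      (M.visitationFrom γ s a πstar s / M.visitation γ πstar s) ^ 2 * M.visitation γ πstar s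
      = M.visitationFrom γ s a πstar s ^ 2 := by
    field_simp
  nlinarith [mul_le_mul_of_nonneg_right h4 hpos.le]

/-- Each state takes a fixed share of a measure of mass at most one, so there is no room for more
than C²/(1 - γ)² states. -/
theorem finite_of_concentrability (hγ0 : 0 ≤ γ) (hγ1 : γ < 1) {πstar : Policy S A} {C : ℝ}
    (h : Concentrability M γ πstar C) : Finite S := by
  by_contra hS
  rw [not_finite_iff_infinite] at hS
  have hg : 0 < (1 - γ) ^ 2 := pow_pos (by linarith) 2
  obtain ⟨n, hn⟩ := exists_nat_gt (C ^ 2 / (1 - γ) ^ 2)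
  obtain ⟨F, hF⟩ := Infinite.exists_subset_card_eq S n
  rw [div_lt_iff₀ hg] at hn
  have h1 : ∑ s ∈ F, (1 - γ) ^ 2 ≤ ∑ s ∈ F, C ^ 2 * M.visitation γ πstar s :=
    Finset.sum_le_sum fun s _ => (M.visitation_ge_of_concentrability hγ0 hγ1 h s).2
  rw [← Finset.mul_sum, Finset.sum_const, hF, nsmul_eq_mul] at h1
  nlinarith [M.sum_visitation_le_one hγ0 hγ1 πstar F, sq_nonneg C]

theorem toReal_transition [Fintype A] (π : Policy S A) (s s' : S) :
    (M.transition π s s').toReal = ∑ a, π.prob s a * (M.P s a s').toReal :=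
  PMF.toReal_bind _ _ _

/-- The flow equation of the visitation measure, tested against a function. -/
theorem sum_visitation_mul [Fintype S] (hγ0 : 0 ≤ γ) (hγ1 : γ < 1) (π : Policy S A) (W : S → ℝ) :
    ∑ s, M.visitation γ π s * W s = (1 - γ) * ∑ s, (M.ρ₀ s).toReal * W s +
      γ * ∑ s, M.visitation γ π s * ∑ s', (M.transition π s s').toReal * W s' := by
  have key : ∀ s', M.visitation γ π s' = (1 - γ) * (M.ρ₀ s').toReal +
      γ * ∑ s, M.visitation γ π s * (M.transition π s s').toReal := by
    intro s'
    simp only [visitation]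
    rw [tsum_discounted_succ hγ0 hγ1 (abs_toReal_le (M.stateLaw π M.ρ₀) s')]
    have h : ∑' t, γ ^ t * (M.stateLaw π M.ρ₀ (t + 1) s').toReal =
        ∑ s, (∑' t, γ ^ t * (M.stateLaw π M.ρ₀ t s).toReal) *
          (M.transition π s s').toReal := by
      simp only [← tsum_mul_right]
      rw [← Summable.tsum_finsetSum fun s _ => (summable_law hγ0 hγ1 _ s).mul_right _]
      refine tsum_congr fun t => ?_
      rw [stateLaw, PMF.toReal_bind, Finset.mul_sum]
      exact Finset.sum_congr rfl fun s _ => by ring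
    rw [h, stateLaw, mul_add, Finset.mul_sum, Finset.mul_sum, Finset.mul_sum]
    congr 1
    exact Finset.sum_congr rfl fun s _ => by ring
  calc ∑ s', M.visitation γ π s' * W s'
      = ∑ s', ((1 - γ) * ((M.ρ₀ s').toReal * W s') +
          γ * ∑ s, M.visitation γ π s * ((M.transition π s s').toReal * W s')) := by
        refine Finset.sum_congr rfl fun s' _ => ?_
        conv_lhs => rw [key s']
        rw [add_mul, mul_assoc γ, Finset.sum_mul]
        simp only [mul_assoc]
    _ = _ := by
        rw [Finset.sum_add_distrib, ← Finset.mul_sum, ← Finset.mul_sum, Finset.sum_comm]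
        simp only [Finset.mul_sum]

end Visitation

/-! ### Action values: Bellman equation, dependence on the policy, performance difference. -/

section QValue

variable [Fintype S] [Fintype A]

theorem markovOp_apply (π : Policy S A) (f : S → A → ℝ) (s : S) (a : A) :
    M.markovOp π f s a = ∑ s', (M.P s a s').toReal * ∑ a', π.prob s' a' * f s' a' :=
  tsum_fintype _

theorem abs_markovOp_le (π : Policy S A) {f : S → A → ℝ} {m : ℝ} (hf : ∀ s a, |f s a| ≤ m)
    (s : S) (a : A) : |M.markovOp π f s a| ≤ m := by
  rw [markovOp_apply]
  exact (M.P s a).abs_sum_toReal_mul_le (π.abs_sum_prob_mul_le hf)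

theorem abs_iterate_markovOp_le (π : Policy S A) {f : S → A → ℝ} {m : ℝ}
    (hf : ∀ s a, |f s a| ≤ m) (t : ℕ) (s : S) (a : A) : |((M.markovOp π)^[t] f) s a| ≤ m := by
  induction t generalizing s a with
  | zero => exact hf s a
  | succ t ih =>
    rw [Function.iterate_succ_apply']
    exact M.abs_markovOp_le π ih s a

theorem abs_qValue_le (hγ0 : 0 ≤ γ) (hγ1 : γ < 1) (π : Policy S A) {b : ℝ}
    (hr : ∀ s a, |M.r s a| ≤ b) (s : S) (a : A) : |M.qValue γ π s a| ≤ b / (1 - γ) :=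
  abs_tsum_discounted_le hγ0 hγ1 fun t => M.abs_iterate_markovOp_le π hr t s a

/-- The Bellman equation. -/
theorem qValue_eq (hγ0 : 0 ≤ γ) (hγ1 : γ < 1) (π : Policy S A) {b : ℝ}
    (hr : ∀ s a, |M.r s a| ≤ b) (s : S) (a : A) :
    M.qValue γ π s a = M.r s a + γ * M.markovOp π (M.qValue γ π) s a := by
  have hb := M.abs_iterate_markovOp_le π hr
  rw [qValue, tsum_discounted_succ hγ0 hγ1 fun t => hb t s a]
  simp only [Function.iterate_zero, id]
  congr 2
  have hs : ∀ s a, Summable fun t => γ ^ t * ((M.markovOp π)^[t] M.r) s a := fun s a =>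
    summable_discounted hγ0 hγ1 fun t => hb t s a
  simp only [markovOp_apply, qValue, ← tsum_mul_left]
  have h1 : ∀ s', ∑ a', ∑' t, π.prob s' a' * (γ ^ t * ((M.markovOp π)^[t] M.r) s' a') =
      ∑' t, ∑ a', π.prob s' a' * (γ ^ t * ((M.markovOp π)^[t] M.r) s' a') := fun s' =>
    (Summable.tsum_finsetSum fun a' _ => (hs s' a').mul_left _).symm
  simp only [h1, ← tsum_mul_left]
  rw [← Summable.tsum_finsetSum fun s' _ =>
    (summable_sum fun a' _ => (hs s' a').mul_left _).mul_left _]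
  refine tsum_congr fun t => ?_
  rw [Function.iterate_succ_apply', markovOp_apply]
  simp only [Finset.mul_sum]
  refine Finset.sum_congr rfl fun s' _ => Finset.sum_congr rfl fun a' _ => by ring

/-- Two policies that are `ε`-close in every state have close action-value functions. -/
theorem abs_qValue_sub_le (hγ0 : 0 ≤ γ) (hγ1 : γ < 1) (π π' : Policy S A) {b ε : ℝ}
    (hr : ∀ s a, |M.r s a| ≤ b) (hε : ∀ s, ∑ a, |π.prob s a - π'.prob s a| ≤ ε) (s : S) (a : A) :
    |M.qValue γ π s a - M.qValue γ π' s a| ≤ ε * (b / (1 - γ)) / (1 - γ) := by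
  have hq := M.abs_qValue_le hγ0 hγ1 π' hr
  have hb : 0 ≤ b / (1 - γ) := (abs_nonneg _).trans (hq s a)
  have hε0 : 0 ≤ ε := (Finset.sum_nonneg fun _ _ => abs_nonneg _).trans (hε s)
  refine abs_le_div_of_discounted hγ1 (ι := S × A)
    (f := fun i => M.qValue γ π i.1 i.2 - M.qValue γ π' i.1 i.2) (fun m hm i => ?_) (s, a)
  obtain ⟨s, a⟩ := i
  have h1 : ∀ s', |∑ a', (π.prob s' a' - π'.prob s' a') * M.qValue γ π' s' a'|
      ≤ ε * (b / (1 - γ)) := fun s' => by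
    refine (Finset.abs_sum_le_sum_abs _ _).trans ?_
    calc _ ≤ ∑ a', |π.prob s' a' - π'.prob s' a'| * (b / (1 - γ)) := by
          refine Finset.sum_le_sum fun a' _ => ?_
          rw [abs_mul]
          exact mul_le_mul_of_nonneg_left (hq s' a') (abs_nonneg _)
      _ ≤ _ := by
          rw [← Finset.sum_mul]
          exact mul_le_mul_of_nonneg_right (hε s') hb
  -- Subtracting the Bellman equations, the difference solves a discounted equation whose source is
  -- the change of policy tested against the bounded Q^{π'}.
  have h2 : M.qValue γ π s a - M.qValue γ π' s a =
      γ * M.markovOp π (fun s a => M.qValue γ π s a - M.qValue γ π' s a) s a +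
      γ * ∑ s', (M.P s a s').toReal *
        ∑ a', (π.prob s' a' - π'.prob s' a') * M.qValue γ π' s' a' := by
    rw [M.qValue_eq hγ0 hγ1 π hr, M.qValue_eq hγ0 hγ1 π' hr]
    simp only [markovOp_apply, mul_sub, sub_mul, Finset.sum_sub_distrib]
    ring
  simp only
  rw [h2]
  have h3 := M.abs_markovOp_le π (f := fun s a => M.qValue γ π s a - M.qValue γ π' s a)
    (fun s a => hm (s, a)) s a
  have h4 := (M.P s a).abs_sum_toReal_mul_le h1
  have h5 : 0 ≤ ε * (b / (1 - γ)) := mul_nonneg hε0 hb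
  calc _ ≤ γ * m + γ * (ε * (b / (1 - γ))) := by
        refine (abs_add_le _ _).trans ?_
        rw [abs_mul, abs_mul, abs_of_nonneg hγ0]
        exact add_le_add (mul_le_mul_of_nonneg_left h3 hγ0) (mul_le_mul_of_nonneg_left h4 hγ0)
    _ ≤ ε * (b / (1 - γ)) + γ * m := by nlinarith

/-- The performance difference lemma. -/
theorem performance_difference (hγ0 : 0 ≤ γ) (hγ1 : γ < 1) (π π' : Policy S A) {b : ℝ}
    (hr : ∀ s a, |M.r s a| ≤ b) :
    (1 - γ) * (∑ s, (M.ρ₀ s).toReal * ∑ a, π'.prob s a * M.qValue γ π' s a -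
      ∑ s, (M.ρ₀ s).toReal * ∑ a, π.prob s a * M.qValue γ π s a) =
    ∑ s, M.visitation γ π' s * ∑ a, (π'.prob s a - π.prob s a) * M.qValue γ π s a := by
  set W : S → ℝ := fun s =>
    ∑ a, π'.prob s a * M.qValue γ π' s a - ∑ a, π.prob s a * M.qValue γ π s a with hW
  -- The flow equation turns the ρ^{π'}-mean of W - γ P^{π'} W into (1 - γ) times the ρ₀-mean of
  -- `W`, so it remains to compute W - γ P^{π'} W.
  have h1 : ∀ s, W s - γ * ∑ s', (M.transition π' s s').toReal * W s' =
      ∑ a, (π'.prob s a - π.prob s a) * M.qValue γ π s a := by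
    intro s
    have h2 : ∑ s', (M.transition π' s s').toReal * W s' =
        ∑ a, π'.prob s a * ∑ s', (M.P s a s').toReal * W s' := by
      simp only [toReal_transition, Finset.sum_mul, Finset.mul_sum]
      rw [Finset.sum_comm]
      exact Finset.sum_congr rfl fun a _ => Finset.sum_congr rfl fun s' _ => by ring
    have h3 : ∀ a, γ * ∑ s', (M.P s a s').toReal * W s' =
        M.qValue γ π' s a - M.qValue γ π s a := by
      intro a
      rw [M.qValue_eq hγ0 hγ1 π hr, M.qValue_eq hγ0 hγ1 π' hr]
      simp only [hW, markovOp_apply, mul_sub, Finset.sum_sub_distrib]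
      ring
    rw [h2, Finset.mul_sum]
    have h4 : ∀ a, γ * (π'.prob s a * ∑ s', (M.P s a s').toReal * W s') =
        π'.prob s a * (M.qValue γ π' s a - M.qValue γ π s a) := fun a => by
      rw [← h3 a]; ring
    simp only [h4]
    simp only [hW, sub_mul, mul_sub, Finset.sum_sub_distrib]
    ring
  have h5 := M.sum_visitation_mul hγ0 hγ1 π' W
  have h6 : ∑ s, M.visitation γ π' s * (W s - γ * ∑ s', (M.transition π' s s').toReal * W s') =
      ∑ s, M.visitation γ π' s * W s -
        γ * ∑ s, M.visitation γ π' s * ∑ s', (M.transition π' s s').toReal * W s' := by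
    simp only [mul_sub, Finset.sum_sub_distrib]
    rw [Finset.mul_sum]
    simp only [mul_left_comm γ]
  simp only [← h1]
  rw [h6, h5, add_sub_cancel_right, ← Finset.sum_sub_distrib]
  simp only [hW, mul_sub]

end QValue

end MDP

/-! ### Exponential tilting and Kullback–Leibler divergence. -/

theorem PMF.toMeasure_absolutelyContinuous_iff {α : Type*} [Countable α] [MeasurableSpace α]
    [MeasurableSingletonClass α] {p q : PMF α} :
    p.toMeasure ≪ q.toMeasure ↔ ∀ a, q a = 0 → p a = 0 := by
  constructor
  · intro h a ha
    rw [← p.toMeasure_apply_singleton a (measurableSet_singleton a)]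
    exact h (by rw [q.toMeasure_apply_singleton a (measurableSet_singleton a), ha])
  · intro h s hs
    rw [PMF.toMeasure_apply_eq_zero_iff _ s.to_countable.measurableSet] at hs ⊢
    exact hs.mono_left fun a ha h0 => ha (h a h0)

/-- By convexity, exp lies below its chord over [-c, c]. -/
theorem Real.exp_le_cosh_add {y c : ℝ} (hc : 0 < c) (hy : |y| ≤ c) :
    Real.exp y ≤ Real.cosh c + y / c * Real.sinh c := by
  obtain ⟨h1, h2⟩ := abs_le.1 hy
  have ha : 0 ≤ (c + y) / (2 * c) := div_nonneg (by linarith) (by linarith)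
  have hb : 0 ≤ (c - y) / (2 * c) := div_nonneg (by linarith) (by linarith)
  have hab : (c + y) / (2 * c) + (c - y) / (2 * c) = 1 := by field_simp; ring
  have h := convexOn_exp.2 (Set.mem_univ c) (Set.mem_univ (-c)) ha hb hab
  simp only [smul_eq_mul] at h
  have h3 : (c + y) / (2 * c) * c + (c - y) / (2 * c) * -c = y := by field_simp; ring
  rw [h3] at h
  refine h.trans (le_of_eq ?_)
  rw [Real.cosh_eq, Real.sinh_eq]
  field_simp
  ring

namespace PMF

variable {α : Type*} [Fintype α] (p q : PMF α) (f : α → ℝ)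

/-- The partition function `∑ₐ p(a) exp(f(a))`. -/
noncomputable def partition : ℝ := ∑ a, (p a).toReal * Real.exp (f a)

theorem partition_pos : 0 < p.partition f := by
  obtain ⟨a, ha⟩ := p.support_nonempty
  exact Finset.sum_pos' (fun a _ => mul_nonneg ENNReal.toReal_nonneg (Real.exp_pos _).le)
    ⟨a, Finset.mem_univ a, mul_pos (ENNReal.toReal_pos ha (p.apply_ne_top a)) (Real.exp_pos _)⟩

/-- The exponential tilting of `p`, with weights proportional to `p(a) exp(f(a))`. -/
noncomputable def softmax : PMF α :=
  PMF.ofFintype (fun a => ENNReal.ofReal ((p a).toReal * Real.exp (f a) / p.partition f)) <| by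
    rw [← ENNReal.ofReal_sum_of_nonneg fun a _ => div_nonneg
      (mul_nonneg ENNReal.toReal_nonneg (Real.exp_pos _).le) (p.partition_pos f).le,
      ← Finset.sum_div]
    change ENNReal.ofReal (p.partition f / p.partition f) = 1
    rw [div_self (p.partition_pos f).ne', ENNReal.ofReal_one]

theorem toReal_softmax (a : α) :
    (p.softmax f a).toReal = (p a).toReal * Real.exp (f a) / p.partition f := by
  rw [softmax, PMF.ofFintype_apply, ENNReal.toReal_ofReal]
  exact div_nonneg (mul_nonneg ENNReal.toReal_nonneg (Real.exp_pos _).le) (p.partition_pos f).le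

theorem toReal_eq_zero_iff {β : Type*} (p : PMF β) (a : β) : (p a).toReal = 0 ↔ p a = 0 := by
  simp [ENNReal.toReal_eq_zero_iff, p.apply_ne_top a]

theorem softmax_eq_zero_iff (a : α) : p.softmax f a = 0 ↔ p a = 0 := by
  rw [← toReal_eq_zero_iff, ← toReal_eq_zero_iff p, toReal_softmax]
  simp [(p.partition_pos f).ne']

/-- The Kullback–Leibler divergence of two distributions on a finite type, as a real sum. -/
noncomputable def realKL : ℝ := ∑ a, (p a).toReal * Real.log ((p a).toReal / (q a).toReal)

variable {p q}

theorem realKL_nonneg (h : ∀ a, q a = 0 → p a = 0) : 0 ≤ p.realKL q := by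
  have h1 : ∀ a, (p a).toReal - (q a).toReal ≤
      (p a).toReal * Real.log ((p a).toReal / (q a).toReal) := by
    intro a
    by_cases hp : p a = 0
    · simp [hp]
    · have hp' : 0 < (p a).toReal := ENNReal.toReal_pos hp (p.apply_ne_top a)
      have hq' : 0 < (q a).toReal :=
        ENNReal.toReal_pos (fun h0 => hp (h a h0)) (q.apply_ne_top a)
      have h2 := Real.one_sub_inv_le_log_of_pos (div_pos hp' hq')
      calc (p a).toReal - (q a).toReal
          = (p a).toReal * (1 - ((p a).toReal / (q a).toReal)⁻¹) := by field_simp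
        _ ≤ _ := mul_le_mul_of_nonneg_left h2 hp'.le
  calc (0 : ℝ) = ∑ a, ((p a).toReal - (q a).toReal) := by
        rw [Finset.sum_sub_distrib, p.sum_toReal, q.sum_toReal, sub_self]
    _ ≤ _ := Finset.sum_le_sum fun a _ => h1 a

/-- Change of the second argument of the divergence under exponential tilting. -/
theorem realKL_softmax (h : ∀ a, q a = 0 → p a = 0) (f : α → ℝ) :
    p.realKL (q.softmax f) =
      p.realKL q - ∑ a, (p a).toReal * f a + Real.log (q.partition f) := by
  have h1 : ∀ a, (p a).toReal * Real.log ((p a).toReal / (q.softmax f a).toReal) =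
      (p a).toReal * Real.log ((p a).toReal / (q a).toReal) - (p a).toReal * f a +
        (p a).toReal * Real.log (q.partition f) := by
    intro a
    by_cases hp : p a = 0
    · simp [hp]
    · have hp' : 0 < (p a).toReal := ENNReal.toReal_pos hp (p.apply_ne_top a)
      have hq' : 0 < (q a).toReal :=
        ENNReal.toReal_pos (fun h0 => hp (h a h0)) (q.apply_ne_top a)
      have hZ := q.partition_pos f
      rw [toReal_softmax, Real.log_div hp'.ne' (by positivity), Real.log_div (by positivity) hZ.ne',
        Real.log_mul hq'.ne' (Real.exp_pos _).ne', Real.log_exp, Real.log_div hp'.ne' hq'.ne']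
      ring
  simp only [realKL, h1, Finset.sum_add_distrib, Finset.sum_sub_distrib, ← Finset.sum_mul,
    p.sum_toReal, one_mul]

/-- Hoeffding's lemma. -/
theorem log_partition_le (p : PMF α) {f : α → ℝ} {u : ℝ} (hf : ∀ a, |f a| ≤ u) :
    Real.log (p.partition f) ≤ ∑ a, (p a).toReal * f a + 2 * u ^ 2 := by
  rw [Real.log_le_iff_le_exp (p.partition_pos f), Real.exp_add]
  set m := ∑ a, (p a).toReal * f a with hm
  have hm' : |m| ≤ u := p.abs_sum_toReal_mul_le hf
  have hu : 0 ≤ u := (abs_nonneg _).trans hm'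
  have hZ : p.partition f = Real.exp m * ∑ a, (p a).toReal * Real.exp (f a - m) := by
    rw [partition, Finset.mul_sum]
    refine Finset.sum_congr rfl fun a _ => ?_
    rw [Real.exp_sub]
    field_simp
  rw [hZ]
  refine mul_le_mul_of_nonneg_left ?_ (Real.exp_pos _).le
  -- The chord bound on [-2u, 2u] has a linear term that averages to zero after centring. This
  -- yields 2u² in place of the sharp u²/2, which affects constants only.
  have hd : ∀ a, |f a - m| ≤ 2 * u := fun a =>
    (abs_sub _ _).trans (by linarith [hf a])
  rcases hu.eq_or_lt with rfl | hu
  · have : ∀ a, f a - m = 0 := fun a => abs_nonpos_iff.1 (by simpa using hd a)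
    simp [this, p.sum_toReal]
  calc ∑ a, (p a).toReal * Real.exp (f a - m)
      ≤ ∑ a, (p a).toReal * (Real.cosh (2 * u) + (f a - m) / (2 * u) * Real.sinh (2 * u)) :=
        Finset.sum_le_sum fun a _ => mul_le_mul_of_nonneg_left
          (Real.exp_le_cosh_add (by linarith) (hd a)) ENNReal.toReal_nonneg
    _ = ∑ a, ((p a).toReal * Real.cosh (2 * u) +
          ((p a).toReal * f a - (p a).toReal * m) * (Real.sinh (2 * u) / (2 * u))) :=
        Finset.sum_congr rfl fun a _ => by ring
    _ = Real.cosh (2 * u) := by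
        rw [Finset.sum_add_distrib, ← Finset.sum_mul, ← Finset.sum_mul, Finset.sum_sub_distrib,
          ← Finset.sum_mul, p.sum_toReal, ← hm]
        ring
    _ ≤ Real.exp ((2 * u) ^ 2 / 2) := Real.cosh_le_exp_half_sq _
    _ = Real.exp (2 * u ^ 2) := by ring_nf

/-- Tilting multiplies each weight by exp(f - log Z), whose exponent is at most 2u in size; for 2u ≤
1 use |exp y - 1| ≤ 2|y|. Otherwise the trivial bound 2 is enough. -/
theorem sum_abs_softmax_sub_le (p : PMF α) {f : α → ℝ} {u : ℝ} (hf : ∀ a, |f a| ≤ u) :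
    ∑ a, |(p.softmax f a).toReal - (p a).toReal| ≤ 4 * u := by
  have hZ := p.partition_pos f
  have hu : 0 ≤ u := by
    obtain ⟨a, -⟩ := p.support_nonempty
    exact (abs_nonneg _).trans (hf a)
  by_cases h1 : 2 * u ≤ 1
  · have hlogZ : |Real.log (p.partition f)| ≤ u := by
      rw [abs_le, Real.le_log_iff_exp_le hZ, Real.log_le_iff_le_exp hZ, partition]
      constructor
      · calc Real.exp (-u) = ∑ a, (p a).toReal * Real.exp (-u) := by
              rw [← Finset.sum_mul, p.sum_toReal, one_mul]
          _ ≤ _ := Finset.sum_le_sum fun a _ => mul_le_mul_of_nonneg_left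
              (Real.exp_le_exp.2 (abs_le.1 (hf a)).1) ENNReal.toReal_nonneg
      · calc _ ≤ ∑ a, (p a).toReal * Real.exp u := Finset.sum_le_sum fun a _ =>
              mul_le_mul_of_nonneg_left (Real.exp_le_exp.2 (abs_le.1 (hf a)).2)
                ENNReal.toReal_nonneg
          _ = Real.exp u := by rw [← Finset.sum_mul, p.sum_toReal, one_mul]
    have h2 : ∀ a, |(p.softmax f a).toReal - (p a).toReal| ≤ (p a).toReal * (4 * u) := by
      intro a
      have h3 : (p.softmax f a).toReal - (p a).toReal =
          (p a).toReal * (Real.exp (f a - Real.log (p.partition f)) - 1) := by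
        rw [toReal_softmax, Real.exp_sub, Real.exp_log hZ]
        ring
      have h4 : |f a - Real.log (p.partition f)| ≤ 2 * u :=
        (abs_sub _ _).trans (by linarith [hf a])
      rw [h3, abs_mul, abs_of_nonneg ENNReal.toReal_nonneg]
      refine mul_le_mul_of_nonneg_left ?_ ENNReal.toReal_nonneg
      exact (Real.abs_exp_sub_one_le (h4.trans h1)).trans (by linarith)
    calc _ ≤ ∑ a, (p a).toReal * (4 * u) := Finset.sum_le_sum fun a _ => h2 a
      _ = 4 * u := by rw [← Finset.sum_mul, p.sum_toReal, one_mul]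
  · calc _ ≤ ∑ a, ((p.softmax f a).toReal + (p a).toReal) := Finset.sum_le_sum fun a _ =>
          (abs_sub _ _).trans (by
            rw [abs_of_nonneg ENNReal.toReal_nonneg, abs_of_nonneg ENNReal.toReal_nonneg])
      _ = 2 := by rw [Finset.sum_add_distrib, sum_toReal, sum_toReal]; norm_num
      _ ≤ _ := by linarith

section KL

variable [MeasurableSpace α] [MeasurableSingletonClass α]

theorem integral_toMeasure (p : PMF α) (g : α → ℝ) :
    ∫ a, g a ∂p.toMeasure = ∑ a, (p a).toReal * g a := by
  rw [PMF.integral_eq_sum]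
  simp

theorem rnDeriv_toMeasure_ae (h : ∀ a, q a = 0 → p a = 0) :
    p.toMeasure.rnDeriv q.toMeasure =ᵐ[q.toMeasure] fun a => p a / q a := by
  have h1 : p.toMeasure = q.toMeasure.withDensity fun a => p a / q a := by
    refine Measure.ext_of_singleton fun a => ?_
    rw [withDensity_apply _ (measurableSet_singleton a), lintegral_singleton,
      p.toMeasure_apply_singleton a (measurableSet_singleton a),
      q.toMeasure_apply_singleton a (measurableSet_singleton a)]
    by_cases ha : q a = 0
    · simp [ha, h a ha]
    · rw [ENNReal.div_mul_cancel ha (q.apply_ne_top a)]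
  rw [h1]
  exact Measure.rnDeriv_withDensity _ (measurable_of_finite _)

/-- Both measures have mass one, so the mass correction in `klDiv` cancels and only the mean
log-ratio is left. -/
theorem klDiv_toMeasure (h : ∀ a, q a = 0 → p a = 0) :
    InformationTheory.klDiv p.toMeasure q.toMeasure = ENNReal.ofReal (p.realKL q) := by
  have hac := toMeasure_absolutelyContinuous_iff.2 h
  rw [InformationTheory.klDiv_of_ac_of_integrable hac Integrable.of_finite]
  congr 1
  have h2 : llr p.toMeasure q.toMeasure =ᵐ[p.toMeasure]
      fun a => Real.log ((p a).toReal / (q a).toReal) := by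
    filter_upwards [hac.ae_le (rnDeriv_toMeasure_ae h)] with a ha
    rw [llr, ha, ENNReal.toReal_div]
  rw [integral_congr_ae h2, integral_toMeasure, realKL]
  simp

theorem klDiv_toMeasure_ne_top_iff :
    InformationTheory.klDiv p.toMeasure q.toMeasure ≠ ∞ ↔ ∀ a, q a = 0 → p a = 0 := by
  constructor
  · intro h
    exact toMeasure_absolutelyContinuous_iff.1 (InformationTheory.klDiv_ne_top_iff.1 h).1
  · intro h
    rw [klDiv_toMeasure h]
    exact ENNReal.ofReal_ne_top

theorem eq_of_realKL_nonpos (h : ∀ a, q a = 0 → p a = 0) (h0 : p.realKL q ≤ 0) : p = q := by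
  have h1 := klDiv_toMeasure h
  rw [ENNReal.ofReal_of_nonpos h0, InformationTheory.klDiv_eq_zero_iff] at h1
  exact PMF.toMeasure_injective h1

end KL

end PMF

/-! ### Stationary means and monotonicity of the Bellman operator. -/

/-- The mean of `f(s, a)` for `s ∼ ν`, `a ∼ π(· | s)`. -/
noncomputable def stateActionMean {S A : Type*} [Fintype S] [Fintype A] (ν : PMF S) (π : Policy S A)
    (f : S → A → ℝ) : ℝ :=
  ∑ s, (ν s).toReal * ∑ a, π.prob s a * f s a

section StateActionMean

variable {S A : Type*} [Fintype S] [Fintype A] (ν : PMF S) (π : Policy S A)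

theorem stateActionMean_mono {f g : S → A → ℝ} (h : ∀ s a, f s a ≤ g s a) :
    stateActionMean ν π f ≤ stateActionMean ν π g :=
  Finset.sum_le_sum fun s _ => mul_le_mul_of_nonneg_left
    (Finset.sum_le_sum fun a _ => mul_le_mul_of_nonneg_left (h s a) (π.prob_nonneg s a))
    ENNReal.toReal_nonneg

theorem stateActionMean_add (f g : S → A → ℝ) :
    stateActionMean ν π (fun s a => f s a + g s a) =
      stateActionMean ν π f + stateActionMean ν π g := by
  simp only [stateActionMean, mul_add, Finset.sum_add_distrib]

theorem stateActionMean_mul_left (c : ℝ) (f : S → A → ℝ) :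
    stateActionMean ν π (fun s a => c * f s a) = c * stateActionMean ν π f := by
  simp only [stateActionMean, Finset.mul_sum, mul_left_comm c]

theorem stateActionMean_const (c : ℝ) : stateActionMean ν π (fun _ _ => c) = c := by
  simp only [stateActionMean, ← Finset.sum_mul, π.sum_prob, ν.sum_toReal, one_mul]

theorem stateActionMean_congr {f g : S → A → ℝ}
    (h : ∀ s a, (ν s).toReal * π.prob s a * (f s a - g s a) = 0) :
    stateActionMean ν π f = stateActionMean ν π g := by
  simp only [stateActionMean, Finset.mul_sum]
  refine Finset.sum_congr rfl fun s _ => Finset.sum_congr rfl fun a _ => ?_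
  linear_combination h s a

end StateActionMean

namespace MDP

variable {S A : Type*} [Fintype S] [Fintype A] (M : MDP S A) (π : Policy S A)

theorem markovOp_mono {f g : S → A → ℝ} (h : ∀ s a, f s a ≤ g s a) (s : S) (a : A) :
    M.markovOp π f s a ≤ M.markovOp π g s a := by
  simp only [markovOp_apply]
  exact Finset.sum_le_sum fun s' _ => mul_le_mul_of_nonneg_left
    (Finset.sum_le_sum fun a' _ => mul_le_mul_of_nonneg_left (h s' a') (π.prob_nonneg s' a'))
    ENNReal.toReal_nonneg

theorem markovOp_add (f g : S → A → ℝ) (s : S) (a : A) :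
    M.markovOp π (fun s a => f s a + g s a) s a = M.markovOp π f s a + M.markovOp π g s a := by
  simp only [markovOp_apply, mul_add, Finset.sum_add_distrib]

theorem markovOp_mul_left (c : ℝ) (f : S → A → ℝ) (s : S) (a : A) :
    M.markovOp π (fun s a => c * f s a) s a = c * M.markovOp π f s a := by
  simp only [markovOp_apply, Finset.mul_sum, mul_left_comm c]

theorem markovOp_const (c : ℝ) (s : S) (a : A) : M.markovOp π (fun _ _ => c) s a = c := by
  simp only [markovOp_apply, ← Finset.sum_mul, π.sum_prob, (M.P s a).sum_toReal, one_mul]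

variable {M π} {ν : PMF S}

/-- The law ν ⊗ π of a state-action pair is invariant under one transition followed by an action
from `π`. -/
theorem IsStationary.stateActionMean_markovOp (h : M.IsStationary π ν) (f : S → A → ℝ) :
    stateActionMean ν π (M.markovOp π f) = stateActionMean ν π f := by
  have h1 : ∀ s', ∑ s, (ν s).toReal * ∑ a, π.prob s a * (M.P s a s').toReal = (ν s').toReal := by
    intro s'
    conv_rhs => rw [← h]
    rw [PMF.toReal_bind]
    simp only [toReal_transition]
  simp only [stateActionMean, markovOp_apply]
  conv_rhs => enter [2, s']; rw [← h1 s', Finset.sum_mul]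
  rw [Finset.sum_comm]
  refine Finset.sum_congr rfl fun s _ => ?_
  simp only [mul_assoc, ← Finset.mul_sum, Finset.sum_mul]
  congr 1
  rw [Finset.sum_comm]
  simp only [Finset.mul_sum]

/-- The Bellman operator is strongly monotone in mean square under the stationary law. -/
theorem IsStationary.mean_sq_le (h : M.IsStationary π ν) {γ : ℝ} (hγ0 : 0 ≤ γ)
    (f : S → A → ℝ) :
    (1 - γ) * stateActionMean ν π (fun s a => f s a ^ 2) ≤
      stateActionMean ν π (fun s a => f s a * (f s a - γ * M.markovOp π f s a)) := by
  have h1 : ∀ s a, f s a ^ 2 + (-γ) * (1 / 2 * f s a ^ 2 +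
      1 / 2 * M.markovOp π (fun s a => f s a ^ 2) s a) ≤
      f s a * (f s a - γ * M.markovOp π f s a) := by
    intro s a
    -- The inequality xy ≤ (x² + y²)/2 is averaged over the next state-action pair; by stationarity
    -- both squares then have the same mean.
    have h2 : f s a * M.markovOp π f s a ≤ 1 / 2 * f s a ^ 2 +
        1 / 2 * M.markovOp π (fun s a => f s a ^ 2) s a := by
      rw [← markovOp_mul_left, ← markovOp_mul_left,
        ← M.markovOp_const π (1 / 2 * f s a ^ 2) s a, ← markovOp_add]
      exact M.markovOp_mono π (fun s' a' => by nlinarith [sq_nonneg (f s a - f s' a')]) s a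
    nlinarith
  refine le_trans (le_of_eq ?_) (stateActionMean_mono ν π h1)
  simp only [stateActionMean_add, stateActionMean_mul_left]
  rw [h.stateActionMean_markovOp]
  ring

end MDP

/-! ### The critic: linear action values and temporal-difference learning. -/

section Features

variable {S A : Type*} {d : ℕ}

theorem linQ_sub (φ : S → A → EuclideanSpace ℝ (Fin d)) (θ θ' : EuclideanSpace ℝ (Fin d))
    (s : S) (a : A) : linQ φ (θ - θ') s a = linQ φ θ s a - linQ φ θ' s a :=
  inner_sub_right _ _ _

theorem abs_linQ_le {φ : S → A → EuclideanSpace ℝ (Fin d)} (hφ : ∀ s a, ‖φ s a‖ ≤ 1) (θ : EuclideanSpace ℝ (Fin d)) (s : S) (a : A) :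
    |linQ φ θ s a| ≤ ‖θ‖ :=
  (abs_real_inner_le_norm _ _).trans
    (mul_le_of_le_one_left (norm_nonneg _) (hφ s a))

theorem sampleProb_nonneg (M : MDP S A) (ν : PMF S) (π : Policy S A) (z : S × A × S × A) :
    0 ≤ sampleProb M ν π z :=
  mul_nonneg (mul_nonneg (mul_nonneg ENNReal.toReal_nonneg (π.prob_nonneg _ _))
    ENNReal.toReal_nonneg) (π.prob_nonneg _ _)

end Features

section Critic

variable {S A : Type*} [Fintype S] [Fintype A] {d : ℕ} {M : MDP S A} {γ : ℝ}
  {φ : S → A → EuclideanSpace ℝ (Fin d)} {ν : PMF S} {π : Policy S A} {μφ : ℝ}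

/-- The mean of (φᵀδ)² is the quadratic form of the feature covariance at `δ`. -/
theorem mul_sq_norm_le_mean (hcov : (featureCov φ ν π - μφ ^ 2 • 1).PosSemidef)
    (δ : EuclideanSpace ℝ (Fin d)) :
    μφ ^ 2 * ‖δ‖ ^ 2 ≤ stateActionMean ν π (fun s a => linQ φ δ s a ^ 2) := by
  have h := hcov.dotProduct_mulVec_nonneg (δ : Fin d → ℝ)
  have h1 : stateActionMean ν π (fun s a => linQ φ δ s a ^ 2) =
      (δ : Fin d → ℝ) ⬝ᵥ (featureCov φ ν π).mulVec δ := by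
    have h2 : ∀ s a, linQ φ δ s a ^ 2 = ∑ i, ∑ j, δ i * (φ s a i * φ s a j) * δ j := by
      intro s a
      have : linQ φ δ s a = ∑ i, φ s a i * δ i := by
        simp [linQ, PiLp.inner_apply, mul_comm]
      rw [this, sq, Finset.sum_mul_sum]
      exact Finset.sum_congr rfl fun i _ => Finset.sum_congr rfl fun j _ => by ring
    simp only [dotProduct, Matrix.mulVec, featureCov, Matrix.of_apply, tsum_fintype,
      stateActionMean, h2, Finset.mul_sum, Finset.sum_mul]
    rw [Finset.sum_congr rfl fun s _ => Finset.sum_comm, Finset.sum_comm]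
    refine Finset.sum_congr rfl fun i _ => ?_
    rw [Finset.sum_congr rfl fun s _ => Finset.sum_comm, Finset.sum_comm]
    refine Finset.sum_congr rfl fun j _ => Finset.sum_congr rfl fun s _ =>
      Finset.sum_congr rfl fun a _ => by ring
  rw [Matrix.sub_mulVec, dotProduct_sub, Matrix.smul_mulVec, Matrix.one_mulVec,
    dotProduct_smul, star_trivial, ← h1] at h
  have h3 : ‖δ‖ ^ 2 = (δ : Fin d → ℝ) ⬝ᵥ δ := by
    rw [EuclideanSpace.real_norm_sq_eq]
    simp [dotProduct, sq]
  rw [h3]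
  simpa using h

/-- Converts uniform bounds on action values into bounds on parameters, both for the size of θ⋆(π)
and for its drift. -/
theorem norm_le_of_abs_linQ_le (hμφ : 0 < μφ)
    (hcov : (featureCov φ ν π - μφ ^ 2 • 1).PosSemidef) {δ : EuclideanSpace ℝ (Fin d)} {b : ℝ}
    (hb : ∀ s a, |linQ φ δ s a| ≤ b) : ‖δ‖ ≤ b / μφ := by
  have hb0 : 0 ≤ b := by
    obtain ⟨s, -⟩ := ν.support_nonempty
    obtain ⟨a, -⟩ := (π s).support_nonempty
    exact (abs_nonneg _).trans (hb s a)
  have h1 := mul_sq_norm_le_mean hcov δ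
  have h2 : stateActionMean ν π (fun s a => linQ φ δ s a ^ 2) ≤ b ^ 2 := by
    rw [← stateActionMean_const ν π (b ^ 2)]
    exact stateActionMean_mono ν π fun s a => sq_le_sq' (abs_le.1 (hb s a)).1 (abs_le.1 (hb s a)).2
  rw [le_div_iff₀ hμφ]
  refine abs_le_of_sq_le_sq' ?_ hb0 |>.2
  nlinarith

/-- Realizability makes the minimizer of the mean squared Bellman error the true parameter. -/
theorem eq_of_isMinOn_msbe (hγ0 : 0 ≤ γ) (hγ1 : γ < 1) (hμφ : 0 < μφ) {b : ℝ}
    (hr : ∀ s a, |M.r s a| ≤ b) (hstat : M.IsStationary π ν)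
    (hcov : (featureCov φ ν π - μφ ^ 2 • 1).PosSemidef) {θs θq : EuclideanSpace ℝ (Fin d)}
    (hθq : ∀ s a, M.qValue γ π s a = linQ φ θq s a)
    (hmin : IsMinOn (msbe M γ φ ν π) Set.univ θs) : θs = θq := by
  have hbell : ∀ s a, linQ φ θq s a - M.r s a - γ * M.markovOp π (linQ φ θq) s a = 0 := by
    intro s a
    have h := M.qValue_eq hγ0 hγ1 π hr s a
    rw [show M.qValue γ π = linQ φ θq from funext₂ hθq] at h
    rw [h]; ring
  have h0 : msbe M γ φ ν π θs ≤ 0 := by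
    refine (isMinOn_univ_iff.1 hmin θq).trans (le_of_eq ?_)
    simp [msbe, sqNorm, hbell]
  set f := linQ φ (θs - θq) with hf
  have he : ∀ s a, linQ φ θs s a - M.r s a - γ * M.markovOp π (linQ φ θs) s a =
      f s a - γ * M.markovOp π f s a := by
    intro s a
    have h1 : M.markovOp π (linQ φ θs) s a =
        M.markovOp π f s a + M.markovOp π (linQ φ θq) s a := by
      rw [← MDP.markovOp_add]
      congr 1
      funext s a
      rw [hf, linQ_sub]; ring
    rw [h1, hf, linQ_sub]
    linear_combination hbell s a
  simp only [msbe, sqNorm, he, tsum_fintype, Finset.sum_mul] at h0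
  have hnn : ∀ s a, 0 ≤ π.prob s a * (f s a - γ * M.markovOp π f s a) ^ 2 * (ν s).toReal :=
    fun s a => mul_nonneg (mul_nonneg (π.prob_nonneg s a) (sq_nonneg _)) ENNReal.toReal_nonneg
  have h2 : ∑ s, ∑ a, π.prob s a * (f s a - γ * M.markovOp π f s a) ^ 2 * (ν s).toReal = 0 :=
    le_antisymm (by linarith) (Finset.sum_nonneg fun s _ => Finset.sum_nonneg fun a _ => hnn s a)
  rw [Finset.sum_eq_zero_iff_of_nonneg fun s _ => Finset.sum_nonneg fun a _ => hnn s a] at h2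
  -- The residual vanishes only on the support of ν ⊗ π, which is all that the strong monotonicity
  -- below sees.
  have h3 : ∀ s a, (ν s).toReal * π.prob s a * (f s a - γ * M.markovOp π f s a) = 0 := by
    intro s a
    have h4 := (Finset.sum_eq_zero_iff_of_nonneg fun a _ => hnn s a).1
      (h2 s (Finset.mem_univ s)) a (Finset.mem_univ a)
    simp only [mul_eq_zero, pow_eq_zero_iff two_ne_zero] at h4 ⊢
    tauto
  have h5 := hstat.mean_sq_le hγ0 f
  have h5' : stateActionMean ν π (fun s a => f s a * (f s a - γ * M.markovOp π f s a)) = 0 :=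
    (stateActionMean_congr ν π fun s a => by linear_combination f s a * h3 s a).trans
      (stateActionMean_const ν π 0)
  rw [h5'] at h5
  have h6 := mul_sq_norm_le_mean hcov (θs - θq)
  have h7 : stateActionMean ν π (fun s a => f s a ^ 2) ≤ 0 := by
    by_contra! hc
    nlinarith [mul_pos (sub_pos.2 hγ1) hc]
  have h8 : ‖θs - θq‖ ^ 2 ≤ 0 := by
    by_contra! hc
    nlinarith [mul_pos (pow_pos hμφ 2) hc]
  exact sub_eq_zero.1 (norm_eq_zero.1 (pow_eq_zero_iff two_ne_zero |>.1
    (le_antisymm h8 (sq_nonneg _))))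

theorem sum_sampleProb_mul (ν : PMF S) (π : Policy S A) (G : S × A × S × A → ℝ) :
    ∑ z, sampleProb M ν π z * G z =
      stateActionMean ν π fun s a => M.markovOp π (fun s' a' => G (s, a, s', a')) s a := by
  simp only [Fintype.sum_prod_type, sampleProb, stateActionMean, MDP.markovOp_apply,
    Finset.mul_sum, mul_assoc]

/-- One step of temporal-difference learning contracts the mean squared distance to the solution
of the Bellman equation, up to the variance of the update. -/
theorem sum_sampleProb_sq_norm_critic_le (hγ0 : 0 ≤ γ) (hγ1 : γ < 1) {b R β : ℝ}
    (hr : ∀ s a, |M.r s a| ≤ b) (hφ : ∀ s a, ‖φ s a‖ ≤ 1) (hstat : M.IsStationary π ν)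
    (hcov : (featureCov φ ν π - μφ ^ 2 • 1).PosSemidef) {θs : EuclideanSpace ℝ (Fin d)}
    (hθs : ∀ s a, M.qValue γ π s a = linQ φ θs s a) (hR : ‖θs‖ ≤ R)
    (hβ0 : 0 ≤ β) (hβ1 : β ≤ (1 - γ) * μφ ^ 2 / 8) (θ : EuclideanSpace ℝ (Fin d)) :
    ∑ z, sampleProb M ν π z * ‖θ - β • tdDirection M γ φ θ z - θs‖ ^ 2 ≤
      (1 - β * ((1 - γ) * μφ ^ 2)) * ‖θ - θs‖ ^ 2 + 2 * β ^ 2 * (b + 2 * R) ^ 2 := by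
  have hbell : ∀ s a, linQ φ θs s a = M.r s a + γ * M.markovOp π (linQ φ θs) s a := by
    intro s a
    have h := M.qValue_eq hγ0 hγ1 π hr s a
    rwa [show M.qValue γ π = linQ φ θs from funext₂ hθs] at h
  set δ := θ - θs with hδ
  set f := linQ φ δ with hf
  have hfe : ∀ s a, linQ φ θ s a = f s a + linQ φ θs s a := fun s a => by
    rw [hf, hδ, linQ_sub]; ring
  set σ := b + 2 * R with hσ
  set c := (1 + 8 * β ^ 2) * ‖δ‖ ^ 2 + 2 * β ^ 2 * σ ^ 2 with hc
  have hpt : ∀ z : S × A × S × A, ‖θ - β • tdDirection M γ φ θ z - θs‖ ^ 2 ≤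
      c + (-2 * β) * (f z.1 z.2.1 * ((linQ φ θ z.1 z.2.1 - M.r z.1 z.2.1) +
        (-γ) * linQ φ θ z.2.2.1 z.2.2.2)) := by
    rintro ⟨s, a, s', a'⟩
    simp only [tdDirection]
    set e := linQ φ θ s a - M.r s a - γ * linQ φ θ s' a' with he
    have h1 : θ - β • e • φ s a - θs = δ - (β * e) • φ s a := by
      rw [hδ, smul_smul]; abel
    have h2 : inner ℝ δ ((β * e) • φ s a) = β * e * f s a := by
      rw [inner_smul_right, real_inner_comm]; rfl
    rw [h1, norm_sub_sq_real, h2, norm_smul, mul_pow, Real.norm_eq_abs, sq_abs]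
    -- With θ = δ + θs, the TD error contains two values of Q_δ, two of Q_θs and one reward.
    have h3 : |e| ≤ 2 * ‖δ‖ + σ := by
      have i1 := abs_le.1 (abs_linQ_le hφ δ s a)
      have i2 := abs_linQ_le hφ δ s' a'
      have i3 := abs_le.1 ((abs_linQ_le hφ θs s a).trans hR)
      have i4 := (abs_linQ_le hφ θs s' a').trans hR
      have i5 := abs_le.1 (hr s a)
      have i6 : |γ * (linQ φ δ s' a' + linQ φ θs s' a')| ≤ ‖δ‖ + R := by
        rw [abs_mul, abs_of_nonneg hγ0]
        exact (mul_le_of_le_one_left (abs_nonneg _) hγ1.le).trans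
          ((abs_add_le _ _).trans (add_le_add i2 i4))
      have i7 := abs_le.1 i6
      rw [he, hfe, hfe s', abs_le]
      constructor <;> linarith [i1.1, i1.2, i3.1, i3.2, i5.1, i5.2, i7.1, i7.2]
    have h4 : e ^ 2 ≤ 8 * ‖δ‖ ^ 2 + 2 * σ ^ 2 := by
      have : e ^ 2 ≤ (2 * ‖δ‖ + σ) ^ 2 := sq_le_sq' (abs_le.1 h3).1 (abs_le.1 h3).2
      nlinarith [sq_nonneg (2 * ‖δ‖ - σ)]
    have h5 : ‖φ s a‖ ^ 2 ≤ 1 := pow_le_one₀ (norm_nonneg _) (hφ s a)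
    have h6 : (β * e) ^ 2 * ‖φ s a‖ ^ 2 ≤ β ^ 2 * (8 * ‖δ‖ ^ 2 + 2 * σ ^ 2) := by
      calc _ ≤ (β * e) ^ 2 := mul_le_of_le_one_right (sq_nonneg _) h5
        _ = β ^ 2 * e ^ 2 := mul_pow _ _ _
        _ ≤ _ := mul_le_mul_of_nonneg_left h4 (sq_nonneg β)
    have h7 : f s a * (linQ φ θ s a - M.r s a + -γ * linQ φ θ s' a') = f s a * e := by
      rw [he]; ring
    rw [h7, hc]
    linarith
  calc ∑ z, sampleProb M ν π z * ‖θ - β • tdDirection M γ φ θ z - θs‖ ^ 2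
      ≤ ∑ z, sampleProb M ν π z * (c + (-2 * β) * (f z.1 z.2.1 *
          ((linQ φ θ z.1 z.2.1 - M.r z.1 z.2.1) + (-γ) * linQ φ θ z.2.2.1 z.2.2.2))) :=
        Finset.sum_le_sum fun z _ =>
          mul_le_mul_of_nonneg_left (hpt z) (sampleProb_nonneg M ν π z)
    _ = c - 2 * β * stateActionMean ν π
          (fun s a => f s a * (f s a - γ * M.markovOp π f s a)) := by
        rw [sum_sampleProb_mul]
        simp only [MDP.markovOp_add, MDP.markovOp_mul_left, MDP.markovOp_const,
          stateActionMean_add, stateActionMean_mul_left, stateActionMean_const]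
        rw [neg_mul, neg_mul, ← sub_eq_add_neg]
        congr 3
        funext s a
        have h1 : M.markovOp π (linQ φ θ) s a =
            M.markovOp π f s a + M.markovOp π (linQ φ θs) s a := by
          rw [← MDP.markovOp_add]
          congr 1
          funext s a
          exact hfe s a
        have h2 : M.markovOp π (fun s' a' => linQ φ θ s' a') s a =
          M.markovOp π (linQ φ θ) s a := rfl
        rw [h2, h1, hfe, hbell s a]
        ring
    _ ≤ c - 2 * β * ((1 - γ) * (μφ ^ 2 * ‖δ‖ ^ 2)) := by
        have h1 := (mul_le_mul_of_nonneg_left (mul_sq_norm_le_mean hcov δ)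
          (sub_pos.2 hγ1).le).trans (hstat.mean_sq_le hγ0 f)
        have h2 := mul_le_mul_of_nonneg_left h1 (mul_nonneg two_pos.le hβ0)
        linarith
    _ ≤ _ := by
        -- The cap on β lets half of the drift 2β(1 - γ)μφ² absorb the quadratic growth 8β².
        have h1 : 8 * β ^ 2 ≤ β * ((1 - γ) * μφ ^ 2) := by nlinarith
        rw [hc]
        nlinarith [mul_le_mul_of_nonneg_right h1 (sq_nonneg ‖δ‖)]

end Critic

/-! ### The actor: mirror descent as exponential tilting. -/

theorem PMF.realKL_self {α : Type*} [Fintype α] (p : PMF α) : p.realKL p = 0 := by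
  refine Finset.sum_eq_zero fun a _ => ?_
  by_cases h : (p a).toReal = 0
  · simp [h]
  · simp [div_self h]

/-- One step of mirror descent with the Kullback–Leibler divergence. -/
theorem PMF.mirror_descent_le {α : Type*} [Fintype α] {p q : PMF α}
    (h : ∀ a, q a = 0 → p a = 0) {f : α → ℝ} {u : ℝ} (hf : ∀ a, |f a| ≤ u) :
    ∑ a, ((p a).toReal - (q a).toReal) * f a ≤
      p.realKL q - p.realKL (q.softmax f) + 2 * u ^ 2 := by
  have h1 := realKL_softmax h f
  have h2 := q.log_partition_le hf
  simp only [sub_mul, Finset.sum_sub_distrib]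
  linarith

section Actor

/-- The averaged divergence as a real sum. -/
noncomputable def realKLBar {S A : Type*} [Fintype S] [Fintype A] (ρ : S → ℝ) (π π' : Policy S A) : ℝ := ∑ s, ρ s * (π s).realKL (π' s)

theorem realKLBar_nonneg {S A : Type*} [Fintype S] [Fintype A] {ρ : S → ℝ} (hρ : ∀ s, 0 ≤ ρ s) {π π' : Policy S A}
    (h : ∀ s a, π' s a = 0 → π s a = 0) : 0 ≤ realKLBar ρ π π' :=
  Finset.sum_nonneg fun s _ => mul_nonneg (hρ s) (PMF.realKL_nonneg (h s))

variable {S A : Type*} [Fintype A] [MeasurableSpace A] [MeasurableSingletonClass A]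
  {d : ℕ} {M : MDP S A} {γ : ℝ} {φ : S → A → EuclideanSpace ℝ (Fin d)}

theorem eq_zero_of_klBar_ne_top {ρ : S → ℝ} (hρ : ∀ s, 0 < ρ s) {π π' : Policy S A}
    (h : klBar ρ π π' ≠ ∞) (s : S) : ∀ a, π' s a = 0 → π s a = 0 := by
  rw [← PMF.klDiv_toMeasure_ne_top_iff]
  intro h0
  refine ENNReal.ne_top_of_tsum_ne_top h s ?_
  rw [h0, ENNReal.top_mul]
  simpa using hρ s

variable [Fintype S]

theorem klBar_eq_ofReal {ρ : S → ℝ} (hρ : ∀ s, 0 ≤ ρ s) {π π' : Policy S A}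
    (h : ∀ s a, π' s a = 0 → π s a = 0) :
    klBar ρ π π' = ENNReal.ofReal (realKLBar ρ π π') := by
  rw [klBar, tsum_fintype, realKLBar, ENNReal.ofReal_sum_of_nonneg fun s _ =>
    mul_nonneg (hρ s) (PMF.realKL_nonneg (h s))]
  refine Finset.sum_congr rfl fun s _ => ?_
  rw [PMF.klDiv_toMeasure (h s), ENNReal.ofReal_mul (hρ s), mul_comm]

theorem actorObjective_eq_coe {α : ℝ} (hα : 0 < α) (θ : EuclideanSpace ℝ (Fin d))
    {πk π : Policy S A} (hρ : ∀ s, 0 ≤ M.visitation γ πk s)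
    (h : ∀ s a, πk s a = 0 → π s a = 0) :
    actorObjective M γ φ α θ πk π =
      ((-(1 - γ)⁻¹ * pairing (M.visitation γ πk) (linQ φ θ) (π.prob - πk.prob) +
        1 / α * realKLBar (M.visitation γ πk) π πk : ℝ) : EReal) := by
  rw [actorObjective, klBar_eq_ofReal hρ h, ← ENNReal.ofReal_mul (by positivity),
    EReal.coe_ennreal_ofReal, max_eq_left, ← EReal.coe_add]
  exact mul_nonneg (by positivity) (realKLBar_nonneg hρ h)

/-- The actor step is the exponential tilting by the critic. -/
theorem eq_softmax_of_isMinOn (hγ1 : γ < 1) {α : ℝ} (hα : 0 < α) {θ : EuclideanSpace ℝ (Fin d)}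
    {πk π : Policy S A} (hρ : ∀ s, 0 < M.visitation γ πk s)
    (hmin : IsMinOn (actorObjective M γ φ α θ πk) Set.univ π) (s : S) :
    π s = (πk s).softmax fun a => α / (1 - γ) * linQ φ θ s a := by
  have h1γ : 0 < 1 - γ := sub_pos.2 hγ1
  set ρ := M.visitation γ πk with hρdef
  have hρ0 : ∀ s, 0 ≤ ρ s := fun s => (hρ s).le
  set f : S → A → ℝ := fun s a => α / (1 - γ) * linQ φ θ s a with hf
  set σ : Policy S A := fun s => (πk s).softmax (f s) with hσ
  have hσac : ∀ s a, πk s a = 0 → σ s a = 0 := fun s a => (PMF.softmax_eq_zero_iff _ _ a).2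
  have hle := isMinOn_univ_iff.1 hmin σ
  -- The tilted policy has a finite objective, so the minimizer has finite divergence and is
  -- absolutely continuous in every state.
  have hfin : klBar ρ π πk ≠ ∞ := by
    intro h0
    rw [actorObjective_eq_coe hα θ hρ0 hσac, actorObjective, ← hρdef, h0,
      ENNReal.mul_top (by simpa using hα)] at hle
    simp only [EReal.coe_ennreal_top, EReal.coe_add_top, top_le_iff] at hle
    exact EReal.coe_ne_top _ hle
  have hac := eq_zero_of_klBar_ne_top hρ hfin
  have hacσ : ∀ s a, σ s a = 0 → π s a = 0 := fun s a h =>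
    hac s a ((PMF.softmax_eq_zero_iff _ _ a).1 h)
  rw [actorObjective_eq_coe hα θ hρ0 hσac, actorObjective_eq_coe hα θ hρ0 hac,
    EReal.coe_le_coe_iff] at hle
  -- Gibbs variational principle: α times the objective is the averaged divergence to `σ` plus a
  -- term free of `π'`, so minimality forces zero divergence to `σ`.
  have hexp : ∀ π' : Policy S A, (∀ s a, πk s a = 0 → π' s a = 0) →
      α * (-(1 - γ)⁻¹ * pairing ρ (linQ φ θ) (π'.prob - πk.prob) +
        1 / α * realKLBar ρ π' πk) = realKLBar ρ π' σ +
        ∑ s, ρ s * (∑ a, πk.prob s a * f s a - Real.log ((πk s).partition (f s))) := by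
    intro π' hπ'
    have h1 : ∀ s, ρ s * (π' s).realKL (σ s) + ρ s * (∑ a, πk.prob s a * f s a -
        Real.log ((πk s).partition (f s))) = ρ s * (π' s).realKL (πk s) -
        α * (1 - γ)⁻¹ * ((∑ a, linQ φ θ s a * (π'.prob - πk.prob) s a) * ρ s) := by
      intro s
      rw [hσ]
      simp only
      rw [PMF.realKL_softmax (hπ' s)]
      have h2 : ∑ a, (π' s a).toReal * f s a - ∑ a, πk.prob s a * f s a =
          α * (1 - γ)⁻¹ * ∑ a, linQ φ θ s a * (π'.prob - πk.prob) s a := by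
        rw [← Finset.sum_sub_distrib, Finset.mul_sum]
        refine Finset.sum_congr rfl fun a _ => ?_
        simp only [hf, Pi.sub_apply, Policy.prob]
        ring
      linear_combination (-ρ s) * h2
    rw [realKLBar, realKLBar, pairing, tsum_fintype, ← Finset.sum_add_distrib,
      Finset.sum_congr rfl fun s _ => h1 s, Finset.sum_sub_distrib, ← Finset.mul_sum]
    field_simp
    ring
  have hle' := mul_le_mul_of_nonneg_left hle hα.le
  rw [← hρdef, hexp π hac, hexp σ hσac] at hle'
  have hσσ : realKLBar ρ σ σ = 0 := by simp [realKLBar, PMF.realKL_self]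
  have hsum : realKLBar ρ π σ = 0 :=
    le_antisymm (by linarith) (realKLBar_nonneg hρ0 hacσ)
  have hs := (Finset.sum_eq_zero_iff_of_nonneg fun s _ =>
    mul_nonneg (hρ0 s) (PMF.realKL_nonneg (hacσ s))).1 hsum s (Finset.mem_univ s)
  exact PMF.eq_of_realKL_nonpos (hacσ s) ((mul_eq_zero.1 hs).resolve_left (hρ s).ne').le

end Actor

/-! ### One-step bounds: optimality gap and drift of the critic's target. -/

section Gap

theorem abs_sum_prob_sub_mul_le {S A : Type*} [Fintype A] (π π' : Policy S A) {f : S → A → ℝ} {u : ℝ}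
    (hf : ∀ s a, |f s a| ≤ u) (s : S) : |∑ a, (π.prob s a - π'.prob s a) * f s a| ≤ 2 * u := by
  simp only [sub_mul, Finset.sum_sub_distrib]
  refine (abs_sub _ _).trans ?_
  linarith [π.abs_sum_prob_mul_le hf s, π'.abs_sum_prob_mul_le hf s]

variable {S A : Type*} [Fintype S] [Fintype A] {d : ℕ} {M : MDP S A} {γ : ℝ}
  {φ : S → A → EuclideanSpace ℝ (Fin d)} {θstar : Policy S A → EuclideanSpace ℝ (Fin d)}

/-- The optimality gap of a policy in terms of one mirror descent step driven by an inexact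
critic. -/
theorem outerLoss_gap_le (hγ0 : 0 ≤ γ) (hγ1 : γ < 1) {b η : ℝ} (hη : 0 ≤ η)
    (hr : ∀ s a, |M.r s a| ≤ b) (hφ : ∀ s a, ‖φ s a‖ ≤ 1)
    (hθ : ∀ π s a, M.qValue γ π s a = linQ φ (θstar π) s a) {πstar π π' : Policy S A}
    (hac : ∀ s a, π s a = 0 → πstar s a = 0) (θ : EuclideanSpace ℝ (Fin d))
    (hπ' : ∀ s, π' s = (π s).softmax fun a => η * linQ φ θ s a) :
    η * ((1 - γ) * (outerLoss M φ θstar π - outerLoss M φ θstar πstar)) ≤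
      realKLBar (M.visitation γ πstar) πstar π - realKLBar (M.visitation γ πstar) πstar π' +
        2 * η ^ 2 * ‖θ‖ ^ 2 + 2 * η * ‖θ - θstar π‖ := by
  set ρ := M.visitation γ πstar with hρ
  have hρ0 : ∀ s, 0 ≤ ρ s := M.visitation_nonneg hγ0 hγ1 πstar
  have hρ1 : ∑ s, ρ s ≤ 1 := M.sum_visitation_le_one hγ0 hγ1 πstar _
  have h1 : (1 - γ) * (outerLoss M φ θstar π - outerLoss M φ θstar πstar) =
      ∑ s, ρ s * ∑ a, (πstar.prob s a - π.prob s a) * linQ φ (θstar π) s a := by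
    have h := M.performance_difference hγ0 hγ1 π πstar hr
    simp only [hθ] at h
    rw [hρ, ← h, outerLoss, outerLoss, pairing, pairing, tsum_fintype, tsum_fintype]
    simp only [mul_comm (linQ _ _ _ _), mul_comm (Finset.sum _ _)]
    ring
  have h2 : ∀ s, η * ∑ a, (πstar.prob s a - π.prob s a) * linQ φ (θstar π) s a ≤
      (πstar s).realKL (π s) - (πstar s).realKL (π' s) +
        (2 * η ^ 2 * ‖θ‖ ^ 2 + 2 * η * ‖θ - θstar π‖) := by
    intro s
    have h3 := PMF.mirror_descent_le (hac s) (f := fun a => η * linQ φ θ s a) (u := η * ‖θ‖)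
      fun a => by
        rw [abs_mul, abs_of_nonneg hη]
        exact mul_le_mul_of_nonneg_left (abs_linQ_le hφ θ s a) hη
    rw [← hπ' s] at h3
    have h4 := neg_le_of_abs_le
      (abs_sum_prob_sub_mul_le πstar π (abs_linQ_le hφ (θ - θstar π)) s)
    -- The mirror step is driven by Q_θ, so the exact critic is split into Q_θ and the error Q_{θ -
    -- θ⋆(π)}.
    have h5 : η * ∑ a, (πstar.prob s a - π.prob s a) * linQ φ (θstar π) s a =
        ∑ a, ((πstar s a).toReal - (π s a).toReal) * (η * linQ φ θ s a) -
        η * ∑ a, (πstar.prob s a - π.prob s a) * linQ φ (θ - θstar π) s a := by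
      simp only [Finset.mul_sum, ← Finset.sum_sub_distrib, linQ_sub, Policy.prob]
      exact Finset.sum_congr rfl fun a _ => by ring
    rw [h5]
    linarith [mul_le_mul_of_nonneg_left h4 hη]
  set e := 2 * η ^ 2 * ‖θ‖ ^ 2 + 2 * η * ‖θ - θstar π‖ with he
  have he0 : 0 ≤ e := by positivity
  rw [h1, add_assoc, ← he]
  calc η * ∑ s, ρ s * ∑ a, (πstar.prob s a - π.prob s a) * linQ φ (θstar π) s a
      = ∑ s, ρ s * (η * ∑ a, (πstar.prob s a - π.prob s a) * linQ φ (θstar π) s a) := by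
        rw [Finset.mul_sum]
        exact Finset.sum_congr rfl fun s _ => by ring
    _ ≤ ∑ s, ρ s * ((πstar s).realKL (π s) - (πstar s).realKL (π' s) + e) :=
        Finset.sum_le_sum fun s _ => mul_le_mul_of_nonneg_left (h2 s) (hρ0 s)
    _ = realKLBar ρ πstar π - realKLBar ρ πstar π' + (∑ s, ρ s) * e := by
        simp only [mul_add, mul_sub, Finset.sum_add_distrib, Finset.sum_sub_distrib, realKLBar,
          Finset.sum_mul]
    _ ≤ _ := by
        have := mul_le_mul_of_nonneg_right hρ1 he0
        linarith

/-- The true critic parameter moves slowly along the actor step. -/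
theorem norm_thetaStar_sub_le (hγ0 : 0 ≤ γ) (hγ1 : γ < 1) {b η μφ : ℝ} (hμφ : 0 < μφ)
    (hη : 0 ≤ η) (hr : ∀ s a, |M.r s a| ≤ b) (hφ : ∀ s a, ‖φ s a‖ ≤ 1)
    (hθ : ∀ π s a, M.qValue γ π s a = linQ φ (θstar π) s a) {π π' : Policy S A} {ν : PMF S}
    (hcov : (featureCov φ ν π - μφ ^ 2 • 1).PosSemidef) (θ : EuclideanSpace ℝ (Fin d))
    (hπ' : ∀ s, π' s = (π s).softmax fun a => η * linQ φ θ s a) :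
    ‖θstar π' - θstar π‖ ≤ 4 * (η * ‖θ‖) * (b / (1 - γ)) / (1 - γ) / μφ := by
  refine norm_le_of_abs_linQ_le hμφ hcov fun s a => ?_
  rw [linQ_sub, ← hθ, ← hθ]
  refine M.abs_qValue_sub_le hγ0 hγ1 π' π hr (fun s => ?_) s a
  simp only [Policy.prob, hπ' s]
  refine PMF.sum_abs_softmax_sub_le _ fun a => ?_
  rw [abs_mul, abs_of_nonneg hη]
  exact mul_le_mul_of_nonneg_left (abs_linQ_le hφ θ s a) hη

end Gap

/-! ### Integration of finitely valued random variables. -/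

section FiniteRange

variable {Ω T : Type*}

/-- With finitely many values, measurable level sets suffice for an arbitrary `g`. Thus no σ-algebra
on policies and no regularity of θ⋆ is needed. -/
theorem measurable_comp_of_finite_range {m : MeasurableSpace Ω} {X : Ω → T}
    (hfin : (Set.range X).Finite) (hX : ∀ x, MeasurableSet (X ⁻¹' {x})) (g : T → ℝ) :
    Measurable fun ω => g (X ω) := by
  intro s _
  have h : (fun ω => g (X ω)) ⁻¹' s = ⋃ x ∈ Set.range X ∩ g ⁻¹' s, X ⁻¹' {x} := by
    ext ω
    simp
  rw [h]
  exact (hfin.subset Set.inter_subset_left).measurableSet_biUnion fun x _ => hX x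

theorem integrable_of_finite_range [MeasurableSpace Ω] {P : Measure Ω} [IsFiniteMeasure P]
    {f : Ω → ℝ} (hf : Measurable f) (hfin : (Set.range f).Finite) : Integrable f P := by
  obtain ⟨C, hC⟩ := hfin.isBounded.exists_norm_le
  exact Integrable.of_bound hf.aestronglyMeasurable C
    (Filter.Eventually.of_forall fun ω => hC _ (Set.mem_range_self ω))

/-- Integration of a function of `(X, Z)` when `Z` has conditional law `q(X)` given a σ-algebra
for which `X` is measurable. -/
theorem integral_eq_integral_sum_of_condExp {m mΩ : MeasurableSpace Ω} (hm : m ≤ mΩ)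
    {P : Measure Ω} [IsProbabilityMeasure P] {X : Ω → T} (hfin : (Set.range X).Finite)
    (hX : ∀ x, MeasurableSet[m] (X ⁻¹' {x})) {V : Type*} [Fintype V] [MeasurableSpace V]
    [MeasurableSingletonClass V] {Z : Ω → V} (hZ : Measurable Z) {q : T → V → ℝ}
    (hq : ∀ z, P⟦Z ⁻¹' {z} | m⟧ =ᵐ[P] fun ω => q (X ω) z) (H : T → V → ℝ) :
    ∫ ω, H (X ω) (Z ω) ∂P = ∫ ω, ∑ z, q (X ω) z * H (X ω) z ∂P := by
  have hmeas : ∀ g : T → ℝ, Measurable[m] fun ω => g (X ω) :=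
    measurable_comp_of_finite_range (m := m) hfin hX
  have hint : ∀ g : T → ℝ, Integrable (fun ω => g (X ω)) P := fun g =>
    integrable_of_finite_range ((hmeas g).mono hm le_rfl)
      ((hfin.image g).subset (by rintro _ ⟨ω, rfl⟩; exact ⟨X ω, ⟨ω, rfl⟩, rfl⟩))
  have hind : ∀ z, MeasurableSet (Z ⁻¹' {z}) := fun z => hZ (measurableSet_singleton z)
  have hint1 : ∀ z, Integrable ((Z ⁻¹' {z}).indicator fun _ => (1 : ℝ)) P := fun z =>
    (integrable_const 1).indicator (hind z)
  have hint2 : ∀ z, Integrable ((fun ω => H (X ω) z) *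
      (Z ⁻¹' {z}).indicator fun _ => (1 : ℝ)) P := by
    intro z
    refine ((hint fun x => H x z).indicator (hind z)).congr (Filter.Eventually.of_forall ?_)
    intro ω
    by_cases h : ω ∈ Z ⁻¹' {z} <;> simp [h]
  have h1 : ∀ ω, H (X ω) (Z ω) = ∑ z, ((fun ω => H (X ω) z) *
      (Z ⁻¹' {z}).indicator fun _ => (1 : ℝ)) ω := by
    intro ω
    rw [Finset.sum_eq_single (Z ω)]
    · simp
    · intro z _ hz
      have : ω ∉ Z ⁻¹' {z} := fun h => hz (by simpa using h.symm)
      simp [this]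
    · simp
  simp only [h1]
  rw [integral_finsetSum _ fun z _ => hint2 z, integral_finsetSum _ fun z _ =>
    hint fun x => q x z * H x z]
  refine Finset.sum_congr rfl fun z _ => ?_
  -- Given `m`, the factor `H (X ω) z` is known and comes out; the indicator of {Z = z} becomes its
  -- conditional probability.
  rw [← integral_condExp hm]
  refine integral_congr_ae ?_
  filter_upwards [condExp_mul_of_stronglyMeasurable_left
    (hmeas fun x => H x z).stronglyMeasurable (hint2 z) (hint1 z), hq z] with ω h2 h3
  rw [h2, Pi.mul_apply, h3, mul_comm]

/-- The mean of a process at an independent uniform time. -/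
theorem integral_uniform_time [MeasurableSpace Ω] {P : Measure Ω} [IsProbabilityMeasure P]
    {V : Type*} [Finite V] [MeasurableSpace V] [MeasurableSingletonClass V] {W : Ω → V}
    (hW : Measurable W) {N : Ω → ℕ} (hN : Measurable N) {K : ℕ} (hK : 0 < K)
    (hunif : ∀ k < K, P (N ⁻¹' {k}) = (K : ℝ≥0∞)⁻¹) (hind : IndepFun N W P)
    {g : ℕ → Ω → ℝ} (hg : ∀ k < K, Function.FactorsThrough (g k) W) :
    Integrable (fun ω => g (N ω) ω) P ∧
      ∫ ω, g (N ω) ω ∂P = (K : ℝ)⁻¹ * ∑ k ∈ Finset.range K, ∫ ω, g k ω ∂P := by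
  set G : ℕ → V → ℝ := fun k => Function.extend W (g k) 0 with hG
  have hGW : ∀ k < K, ∀ ω, G k (W ω) = g k ω := fun k hk ω => (hg k hk).extend_apply 0 ω
  set c : ℕ → ℕ → ℝ := fun k n => if n = k then 1 else 0 with hc
  have hcm : ∀ k, Measurable fun ω => c k (N ω) := fun k => (measurable_of_countable (c k)).comp hN
  have hGm : ∀ k, Measurable fun ω => G k (W ω) := fun k => (measurable_of_countable (G k)).comp hW
  have hci : ∀ k, Integrable (fun ω => c k (N ω)) P := fun k =>
    integrable_of_finite_range (hcm k) ((Set.toFinite {1, 0}).subset (by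
      rintro _ ⟨ω, rfl⟩
      by_cases h : N ω = k <;> simp [hc, h]))
  have hGi : ∀ k, Integrable (fun ω => G k (W ω)) P := fun k =>
    integrable_of_finite_range (hGm k) ((Set.finite_range (G k)).subset
      (by rintro _ ⟨ω, rfl⟩; exact ⟨W ω, rfl⟩))
  have hindk : ∀ k, IndepFun (fun ω => c k (N ω)) (fun ω => G k (W ω)) P := fun k =>
    hind.comp (measurable_of_countable (c k)) (measurable_of_countable (G k))
  have hprod : ∀ k, Integrable (fun ω => c k (N ω) * G k (W ω)) P := fun k =>
    (hindk k).integrable_mul (hci k) (hGi k)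
  -- The K masses 1/K already add up to one, so other values of `N` are null.
  have hlt : ∀ᵐ ω ∂P, N ω < K := by
    have h1 : P (N ⁻¹' Set.Iio K) = 1 := by
      have h2 : N ⁻¹' Set.Iio K = ⋃ k ∈ Finset.range K, N ⁻¹' {k} := by
        ext ω
        simp
      rw [h2, measure_biUnion_finset
        (fun i _ j _ hij => Disjoint.preimage _ (Set.disjoint_singleton.2 hij))
        fun k _ => hN (measurableSet_singleton k),
        Finset.sum_congr rfl fun k hk => hunif k (Finset.mem_range.1 hk)]
      simp only [Finset.sum_const, Finset.card_range, nsmul_eq_mul]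
      exact ENNReal.mul_inv_cancel (by simpa using hK.ne') (ENNReal.natCast_ne_top K)
    exact (prob_compl_eq_zero_iff (hN measurableSet_Iio)).2 h1
  have hae : (fun ω => g (N ω) ω) =ᵐ[P]
      fun ω => ∑ k ∈ Finset.range K, c k (N ω) * G k (W ω) := by
    filter_upwards [hlt] with ω hω
    rw [Finset.sum_eq_single (N ω)]
    · simp [hc, hGW _ hω]
    · intro k _ hk
      simp [hc, hk.symm]
    · intro h
      exact absurd (Finset.mem_range.2 hω) h
  refine ⟨(integrable_finsetSum _ fun k _ => hprod k).congr hae.symm, ?_⟩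
  rw [integral_congr_ae hae, integral_finsetSum _ fun k _ => hprod k, Finset.mul_sum]
  refine Finset.sum_congr rfl fun k hk => ?_
  have hk' := Finset.mem_range.1 hk
  have h3 : ∫ ω, c k (N ω) ∂P = (K : ℝ)⁻¹ := by
    have h4 : (fun ω => c k (N ω)) = (N ⁻¹' {k}).indicator fun _ => (1 : ℝ) := by
      funext ω
      by_cases h : N ω = k <;> simp [hc, h]
    rw [h4, integral_indicator_const _ (hN (measurableSet_singleton k)), Measure.real, hunif k hk']
    simp
  rw [(hindk k).integral_fun_mul_eq_mul_integral (hcm k).aestronglyMeasurable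
    (hGm k).aestronglyMeasurable, h3]
  simp only [hGW k hk']

end FiniteRange

/-! ### Deterministic two-timescale recursions. -/

section Rates

/-- A perturbed contraction has small averages. -/
theorem sum_le_of_perturbed_contraction {K : ℕ} (hK : 0 < K) {E : ℕ → ℝ} {lam m b : ℝ}
    (hm : 0 ≤ m) (hlam : 0 ≤ lam) (hE : ∀ k, 0 ≤ E k) (h0 : E 0 ≤ b)
    (h : ∀ k < K, E (k + 1) ≤ (1 - lam / 2) * E k + m / K * (E k + 1)) :
    lam / 2 * ∑ k ∈ Finset.range K, E k ≤ b + m * (Real.exp m * (b + 1)) := by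
  have hK' : (0 : ℝ) < K := Nat.cast_pos.2 hK
  have hmK : 0 ≤ m / K := by positivity
  have hb : 0 ≤ b := (hE 0).trans h0
  -- Dropping the contraction gives a discrete Grönwall bound, uniform up to time K; the contraction
  -- is used afterwards, when telescoping.
  have h1 : ∀ k ≤ K, E k + 1 ≤ (1 + m / K) ^ k * (b + 1) := by
    intro k
    induction k with
    | zero => intro _; simpa using h0
    | succ k ih =>
      intro hk
      have i1 := ih (by omega)
      have i2 := h k (by omega)
      have i3 : E (k + 1) + 1 ≤ (1 + m / K) * (E k + 1) := by nlinarith [mul_nonneg hlam (hE k)]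
      rw [pow_succ', mul_assoc]
      exact i3.trans (mul_le_mul_of_nonneg_left i1 (by linarith))
  have h2 : ∀ k ≤ K, E k + 1 ≤ Real.exp m * (b + 1) := by
    intro k hk
    refine (h1 k hk).trans (mul_le_mul_of_nonneg_right ?_ (by linarith))
    calc (1 + m / K) ^ k ≤ (1 + m / K) ^ K := pow_le_pow_right₀ (by linarith) hk
      _ ≤ Real.exp (m / K) ^ K :=
        pow_le_pow_left₀ (by linarith) (by linarith [Real.add_one_le_exp (m / K)]) K
      _ = Real.exp m := by
        rw [← Real.exp_nat_mul]
        congr 1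
        field_simp
  set U := Real.exp m * (b + 1)
  have h3 : ∀ k < K, lam / 2 * E k ≤ E k - E (k + 1) + m / K * U := by
    intro k hk
    have := mul_le_mul_of_nonneg_left (h2 k hk.le) hmK
    linarith [h k hk]
  calc lam / 2 * ∑ k ∈ Finset.range K, E k = ∑ k ∈ Finset.range K, lam / 2 * E k := by
        rw [Finset.mul_sum]
    _ ≤ ∑ k ∈ Finset.range K, (E k - E (k + 1) + m / K * U) :=
        Finset.sum_le_sum fun k hk => h3 k (Finset.mem_range.1 hk)
    _ = E 0 - E K + m * U := by
        rw [Finset.sum_add_distrib, Finset.sum_range_sub', Finset.sum_const, Finset.card_range,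
          nsmul_eq_mul]
        field_simp
    _ ≤ _ := by linarith [hE K]

/-- Rates of a two-timescale recursion: `E` and `D` are the critic errors before and after the
critic step, `G` the optimality gap and `Φ` the divergence from the optimal policy. -/
theorem two_timescale_rates (b g e₁ e₂ l₁ l₂ b₂ σ L R : ℝ) (hb : 0 ≤ b) (hg : 0 < g)
    (he₁ : 0 < e₁) (he₂ : 0 ≤ e₂) (hl₁ : 0 < l₁) (hl₂ : 0 ≤ l₂) (hb₂ : 0 ≤ b₂) :
    ∃ C : ℝ, ∀ (K : ℕ) (x η lam β : ℝ) (E D Φ G : ℕ → ℝ), 0 < K → 0 < x → x ≤ 1 →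
      (K : ℝ) * x ^ 4 = 1 → e₁ * x ^ 3 ≤ η → η ≤ e₂ * x ^ 3 → l₁ * x ^ 2 ≤ lam → lam ≤ l₂ →
      β ^ 2 ≤ b₂ * x ^ 4 → (∀ k, 0 ≤ E k) → (∀ k, 0 ≤ D k) → E 0 ≤ b → Φ 0 ≤ b → 0 ≤ Φ K →
      (∀ k < K, D k ≤ (1 - lam) * E k + 2 * β ^ 2 * σ ^ 2) →
      (∀ k < K, E (k + 1) ≤ (1 + lam / 2) * D k +
        (1 + 2 / lam) * (L ^ 2 * η ^ 2 * (2 * D k + 2 * R ^ 2))) →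
      (∀ k < K, η * (g * G k) ≤ Φ k - Φ (k + 1) + 4 * η ^ 2 * (D k + R ^ 2) +
        η * (x + D k / x)) →
      (K : ℝ)⁻¹ * ∑ k ∈ Finset.range K, G k ≤ C * x ∧
        (K : ℝ)⁻¹ * ∑ k ∈ Finset.range K, D k ≤ C * x ^ 2 := by
  set v := 2 * b₂ * σ ^ 2 with hv
  have hv0 : 0 ≤ v := by positivity
  set w := 2 * L ^ 2 * ((1 + 2 / l₁) * e₂ ^ 2) with hw
  have hw0 : 0 ≤ w := by positivity
  set m := (1 + l₂ / 2) * v + w * (1 + v + R ^ 2) with hm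
  have hm0 : 0 ≤ m := by positivity
  set U := b + m * (Real.exp m * (b + 1)) with hU
  have hU0 : 0 ≤ U := by positivity
  set CD := 2 * U / l₁ + v with hCD
  have hCD0 : 0 ≤ CD := by positivity
  set CG := (b / e₁ + 4 * e₂ * (CD + R ^ 2) + 1 + CD) / g with hCG
  have hCG0 : 0 ≤ CG := by positivity
  clear_value v w m U CD CG
  refine ⟨CG + CD, ?_⟩
  intro K x η lam β E D Φ G hK hx hx1 hKx hη₁ hη₂ hlam₁ hlam₂ hβ hE hD hE0 hΦ0 hΦK hD1 hE1 hG1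
  have hK' : (0 : ℝ) < K := Nat.cast_pos.2 hK
  have hKinv : (K : ℝ)⁻¹ = x ^ 4 := by
    exact (eq_inv_of_mul_eq_one_right hKx).symm
  have hlam : 0 < lam := lt_of_lt_of_le (by positivity) hlam₁
  have hη : 0 < η := lt_of_lt_of_le (by positivity) hη₁
  have hx2 : x ^ 2 ≤ 1 := pow_le_one₀ hx.le hx1
  have hx4 : x ^ 4 ≤ 1 := pow_le_one₀ hx.le hx1
  have hx42 : x ^ 4 ≤ x ^ 2 := pow_le_pow_of_le_one hx.le hx1 (by norm_num)
  have hx3 : x ^ 3 ≤ x := pow_le_of_le_one hx.le hx1 (by norm_num)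
  have hvb : 2 * β ^ 2 * σ ^ 2 ≤ v * x ^ 4 := by
    have := mul_le_mul_of_nonneg_right hβ (sq_nonneg σ)
    rw [hv]; linarith
  have hη2 : η ^ 2 ≤ e₂ ^ 2 * x ^ 6 := by
    calc η ^ 2 ≤ (e₂ * x ^ 3) ^ 2 := pow_le_pow_left₀ hη.le hη₂ 2
      _ = _ := by ring
  -- Drift of the target per step: η²/λ is at most of order x⁶/x² = x⁴ = 1/K.
  have hwb : (1 + 2 / lam) * (L ^ 2 * η ^ 2 * 2) ≤ w * x ^ 4 := by
    have i1 : 2 / lam ≤ 2 / (l₁ * x ^ 2) := by gcongr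
    have i2 : (1 + 2 / lam) * η ^ 2 ≤ (1 + 2 / (l₁ * x ^ 2)) * (e₂ ^ 2 * x ^ 6) := by
      gcongr
    have i3 : (1 + 2 / (l₁ * x ^ 2)) * (e₂ ^ 2 * x ^ 6) =
        e₂ ^ 2 * x ^ 4 * (x ^ 2 + 2 / l₁) := by
      field_simp
    have i4 : e₂ ^ 2 * x ^ 4 * (x ^ 2 + 2 / l₁) ≤ e₂ ^ 2 * x ^ 4 * (1 + 2 / l₁) := by
      gcongr
    calc _ = 2 * L ^ 2 * ((1 + 2 / lam) * η ^ 2) := by ring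
      _ ≤ 2 * L ^ 2 * (e₂ ^ 2 * x ^ 4 * (1 + 2 / l₁)) :=
        mul_le_mul_of_nonneg_left (i2.trans (i3.trans_le i4)) (by positivity)
      _ = _ := by rw [hw]; ring
  have hDE : ∀ k < K, D k ≤ E k + v * x ^ 4 := fun k hk => by
    have := mul_nonneg hlam.le (hE k)
    linarith [hD1 k hk]
  have hvx : v * x ^ 4 ≤ v := mul_le_of_le_one_right hv0 hx4
  have hrec : ∀ k < K, E (k + 1) ≤ (1 - lam / 2) * E k + m / K * (E k + 1) := by
    intro k hk
    -- Young's loss 1 + λ/2 costs only half of the contraction: (1 + λ/2)(1 - λ) ≤ 1 - λ/2.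
    have i1 : (1 + lam / 2) * D k ≤ (1 - lam / 2) * E k + (1 + l₂ / 2) * (v * x ^ 4) := by
      have j1 := mul_le_mul_of_nonneg_left (hD1 k hk) (by linarith : 0 ≤ 1 + lam / 2)
      have j2 : (1 + lam / 2) * (2 * β ^ 2 * σ ^ 2) ≤ (1 + l₂ / 2) * (v * x ^ 4) :=
        mul_le_mul (by linarith) hvb (by positivity) (by positivity)
      have j3 : (1 + lam / 2) * ((1 - lam) * E k + 2 * β ^ 2 * σ ^ 2) = (1 - lam / 2) * E k -
          lam ^ 2 * E k / 2 + (1 + lam / 2) * (2 * β ^ 2 * σ ^ 2) := by ring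
      have j4 := mul_nonneg (sq_nonneg lam) (hE k)
      linarith
    have i2 : (1 + 2 / lam) * (L ^ 2 * η ^ 2 * (2 * D k + 2 * R ^ 2)) ≤
        w * x ^ 4 * (E k + v + R ^ 2) := by
      calc _ = (1 + 2 / lam) * (L ^ 2 * η ^ 2 * 2) * (D k + R ^ 2) := by ring
        _ ≤ _ := mul_le_mul hwb (by linarith [hDE k hk])
          (add_nonneg (hD k) (sq_nonneg R)) (by positivity)
    have i3 : w * x ^ 4 * (E k + v + R ^ 2) + (1 + l₂ / 2) * (v * x ^ 4) ≤
        m * x ^ 4 * (E k + 1) := by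
      have j1 : 0 ≤ (1 + l₂ / 2) * v * x ^ 4 * E k :=
        mul_nonneg (by positivity) (hE k)
      have j2 : 0 ≤ w * (v + R ^ 2) * x ^ 4 * E k :=
        mul_nonneg (by positivity) (hE k)
      have j3 : 0 ≤ w * x ^ 4 := by positivity
      have j4 : m * x ^ 4 * (E k + 1) = w * x ^ 4 * (E k + v + R ^ 2) +
          (1 + l₂ / 2) * (v * x ^ 4) + (1 + l₂ / 2) * v * x ^ 4 * E k +
          w * (v + R ^ 2) * x ^ 4 * E k + w * x ^ 4 := by rw [hm]; ring
      linarith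
    rw [div_eq_mul_inv m, hKinv]
    linarith [hE1 k hk]
  have hsum := sum_le_of_perturbed_contraction hK hm0 hlam.le hE hE0 hrec
  rw [← hU] at hsum
  have hSE0 : 0 ≤ ∑ k ∈ Finset.range K, E k := Finset.sum_nonneg fun k _ => hE k
  have hSE : x ^ 4 * ∑ k ∈ Finset.range K, E k ≤ 2 * U / l₁ * x ^ 2 := by
    have i1 : l₁ * x ^ 2 * ∑ k ∈ Finset.range K, E k ≤ 2 * U := by
      have := mul_le_mul_of_nonneg_right hlam₁ hSE0
      linarith
    rw [div_mul_eq_mul_div, le_div_iff₀ hl₁]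
    have := mul_le_mul_of_nonneg_right i1 (sq_nonneg x)
    linarith
  have hSD : x ^ 4 * ∑ k ∈ Finset.range K, D k ≤ CD * x ^ 2 := by
    have i1 : ∑ k ∈ Finset.range K, D k ≤ ∑ k ∈ Finset.range K, E k + v := by
      calc _ ≤ ∑ k ∈ Finset.range K, (E k + v * x ^ 4) :=
            Finset.sum_le_sum fun k hk => hDE k (Finset.mem_range.1 hk)
        _ = ∑ k ∈ Finset.range K, E k + v * (K * x ^ 4) := by
            rw [Finset.sum_add_distrib, Finset.sum_const, Finset.card_range, nsmul_eq_mul]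
            ring
        _ = _ := by rw [hKx, mul_one]
    have i2 := mul_le_mul_of_nonneg_left i1 (by positivity : 0 ≤ x ^ 4)
    have i3 := mul_le_mul_of_nonneg_left hx42 hv0
    rw [hCD]
    linarith
  have hSD0 : 0 ≤ ∑ k ∈ Finset.range K, D k := Finset.sum_nonneg fun k _ => hD k
  rw [hKinv]
  refine ⟨?_, hSD.trans (mul_le_mul_of_nonneg_right (by linarith) (sq_nonneg x))⟩
  have hS : η * (g * ∑ k ∈ Finset.range K, G k) ≤ b +
      4 * η ^ 2 * (∑ k ∈ Finset.range K, D k + K * R ^ 2) +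
      η * (K * x + (∑ k ∈ Finset.range K, D k) / x) := by
    calc _ = ∑ k ∈ Finset.range K, η * (g * G k) := by simp only [Finset.mul_sum]
      _ ≤ ∑ k ∈ Finset.range K, (Φ k - Φ (k + 1) + 4 * η ^ 2 * (D k + R ^ 2) +
          η * (x + D k / x)) := Finset.sum_le_sum fun k hk => hG1 k (Finset.mem_range.1 hk)
      _ = Φ 0 - Φ K + 4 * η ^ 2 * (∑ k ∈ Finset.range K, D k + K * R ^ 2) +
          η * (K * x + (∑ k ∈ Finset.range K, D k) / x) := by
        rw [Finset.sum_add_distrib, Finset.sum_add_distrib, Finset.sum_range_sub',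
          ← Finset.mul_sum, ← Finset.mul_sum, Finset.sum_add_distrib, Finset.sum_add_distrib,
          Finset.sum_const, Finset.sum_const, Finset.card_range, nsmul_eq_mul, nsmul_eq_mul,
          Finset.sum_div]
      _ ≤ _ := by linarith
  -- Multiplying by x⁴/η averages over K steps and removes the step size; each of the three terms is
  -- then O(x).
  have hS2 : g * (x ^ 4 * ∑ k ∈ Finset.range K, G k) ≤
      b * x ^ 4 / η + 4 * η * (x ^ 4 * ∑ k ∈ Finset.range K, D k + R ^ 2) +
      (x + x ^ 4 * (∑ k ∈ Finset.range K, D k) / x) := by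
    have i1 := mul_le_mul_of_nonneg_left hS (by positivity : 0 ≤ x ^ 4 / η)
    have i2 : x ^ 4 / η * (b + 4 * η ^ 2 * (∑ k ∈ Finset.range K, D k + K * R ^ 2) +
        η * (K * x + (∑ k ∈ Finset.range K, D k) / x)) =
        b * x ^ 4 / η + 4 * η * (x ^ 4 * ∑ k ∈ Finset.range K, D k + (K * x ^ 4) * R ^ 2) +
        ((K * x ^ 4) * x + x ^ 4 * (∑ k ∈ Finset.range K, D k) / x) := by
      field_simp
    have i3 : x ^ 4 / η * (η * (g * ∑ k ∈ Finset.range K, G k)) =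
        g * (x ^ 4 * ∑ k ∈ Finset.range K, G k) := by
      field_simp
    rw [i2, i3, hKx, one_mul, one_mul] at i1
    exact i1
  have t1 : b * x ^ 4 / η ≤ b / e₁ * x := by
    calc b * x ^ 4 / η ≤ b * x ^ 4 / (e₁ * x ^ 3) := by gcongr
      _ = b / e₁ * x := by field_simp
  have t2 : 4 * η * (x ^ 4 * ∑ k ∈ Finset.range K, D k + R ^ 2) ≤
      4 * e₂ * (CD + R ^ 2) * x := by
    have j1 : x ^ 4 * ∑ k ∈ Finset.range K, D k ≤ CD :=
      hSD.trans (mul_le_of_le_one_right hCD0 hx2)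
    have j2 : η ≤ e₂ * x := hη₂.trans (mul_le_mul_of_nonneg_left hx3 he₂)
    calc _ ≤ 4 * (e₂ * x) * (CD + R ^ 2) := by gcongr
      _ = _ := by ring
  have t3 : x ^ 4 * (∑ k ∈ Finset.range K, D k) / x ≤ CD * x := by
    rw [div_le_iff₀ hx]
    linarith
  have t4 : x ^ 4 * ∑ k ∈ Finset.range K, G k ≤ CG * x := by
    rw [hCG, div_mul_eq_mul_div, le_div_iff₀ hg]
    linarith
  exact t4.trans (mul_le_mul_of_nonneg_right (by linarith) hx.le)

end Rates

/-! ### The iterates as functions of the samples. -/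

section FactorsThrough

variable {Ω T V : Type*} [Finite V] {W : Ω → V}

theorem Function.FactorsThrough.finite_range [Nonempty T] {f : Ω → T}
    (h : Function.FactorsThrough f W) : (Set.range f).Finite := by
  obtain ⟨e, rfl⟩ := (Function.factorsThrough_iff f).1 h
  exact (Set.finite_range e).subset (Set.range_comp_subset_range W e)

theorem Function.FactorsThrough.integrable [MeasurableSpace Ω] {P : Measure Ω}
    [IsFiniteMeasure P] [MeasurableSpace V] [MeasurableSingletonClass V] (hW : Measurable W)
    {f : Ω → ℝ} (h : Function.FactorsThrough f W) : Integrable f P := by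
  refine integrable_of_finite_range ?_ h.finite_range
  obtain ⟨e, rfl⟩ := (Function.factorsThrough_iff f).1 h
  exact (measurable_of_countable e).comp hW

end FactorsThrough

namespace IsTTNAC

variable {S A : Type*} [Fintype S] [MeasurableSpace S]
  [Fintype A] [MeasurableSpace A] {d : ℕ}
  {M : MDP S A} {γ : ℝ} {φ : S → A → EuclideanSpace ℝ (Fin d)} {μ : Policy S A → PMF S}
  {α β : ℝ} {K : ℕ} {θ₀ : EuclideanSpace ℝ (Fin d)} {π₀ πstar : Policy S A} {Ω : Type*}
  {mΩ : MeasurableSpace Ω} {Pr : Measure Ω} {ℱ : Filtration ℕ mΩ} {Z : ℕ → Ω → S × A × S × A}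
  {θ : ℕ → Ω → EuclideanSpace ℝ (Fin d)} {π : ℕ → Ω → Policy S A}

theorem measurableSet_preimage (h : IsTTNAC M γ φ μ α β K θ₀ π₀ Pr ℱ Z θ π) {k : ℕ} (hk : k ≤ K)
    (x : EuclideanSpace ℝ (Fin d) × Policy S A) :
    MeasurableSet[ℱ k] ((fun ω => (θ k ω, π k ω)) ⁻¹' {x}) := by
  have h1 : (fun ω => (θ k ω, π k ω)) ⁻¹' {x} = θ k ⁻¹' {x.1} ∩
      ⋂ s, ⋂ a, (fun ω => (π k ω).prob s a) ⁻¹' {x.2.prob s a} := by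
    ext ω
    simp only [Set.mem_preimage, Set.mem_singleton_iff, Set.mem_inter_iff, Set.mem_iInter,
      Prod.ext_iff]
    exact and_congr_right fun _ => ⟨fun h s a => by rw [h], Policy.prob_ext⟩
  rw [h1]
  exact (h.adapted_critic k hk (measurableSet_singleton _)).inter
    (MeasurableSet.iInter fun s => MeasurableSet.iInter fun a =>
      h.adapted_actor k hk s a (measurableSet_singleton _))

variable [MeasurableSingletonClass A]

/-- Equal supports with π₀ make every state visited under the current policy, so the weighted
minimization determines the next policy in every state. -/
theorem actor_step_eq (h : IsTTNAC M γ φ μ α β K θ₀ π₀ Pr ℱ Z θ π) (hγ0 : 0 ≤ γ) (hγ1 : γ < 1)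
    (hα : 0 < α) (hpos : ∀ s, 0 < M.visitation γ πstar s)
    (hac : ∀ s a, π₀ s a = 0 → πstar s a = 0) {k : ℕ} (hk : k < K) {ω : Ω}
    (hsupp : ∀ s a, π k ω s a = 0 ↔ π₀ s a = 0) (s : S) :
    π (k + 1) ω s = (π k ω s).softmax fun a => α / (1 - γ) * linQ φ (θ (k + 1) ω) s a :=
  eq_softmax_of_isMinOn hγ1 hα (fun s => M.visitation_pos_mono hγ0 hγ1
    (fun s a h1 h2 => h1 (hac s a ((hsupp s a).1 h2))) (hpos s)) (h.actor_step k hk ω) s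

/-- The actor steps do not change the supports of the policies. -/
theorem actor_eq_zero_iff (h : IsTTNAC M γ φ μ α β K θ₀ π₀ Pr ℱ Z θ π) (hγ0 : 0 ≤ γ)
    (hγ1 : γ < 1) (hα : 0 < α) (hpos : ∀ s, 0 < M.visitation γ πstar s)
    (hac : ∀ s a, π₀ s a = 0 → πstar s a = 0) {k : ℕ} (hk : k ≤ K) (ω : Ω) :
    ∀ s a, π k ω s a = 0 ↔ π₀ s a = 0 := by
  induction k with
  | zero => simp [h.init_actor]
  | succ k ih =>
    intro s a
    rw [h.actor_step_eq hγ0 hγ1 hα hpos hac hk (ih (by omega)), PMF.softmax_eq_zero_iff,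
      ih (by omega)]

/-- The iterates are functions of the samples drawn so far. -/
theorem iterates_congr (h : IsTTNAC M γ φ μ α β K θ₀ π₀ Pr ℱ Z θ π) (hγ0 : 0 ≤ γ)
    (hγ1 : γ < 1) (hα : 0 < α) (hpos : ∀ s, 0 < M.visitation γ πstar s)
    (hac : ∀ s a, π₀ s a = 0 → πstar s a = 0) {ω ω' : Ω} {k : ℕ} (hk : k ≤ K)
    (hZ : ∀ j < k, Z j ω = Z j ω') : θ k ω = θ k ω' ∧ π k ω = π k ω' := by
  induction k with
  | zero => simp [h.init_actor, h.init_critic]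
  | succ k ih =>
    obtain ⟨h1, h2⟩ := ih (by omega) fun j hj => hZ j (by omega)
    have h3 : θ (k + 1) ω = θ (k + 1) ω' := by
      rw [h.critic_step k hk, h.critic_step k hk, h1, hZ k k.lt_succ_self]
    refine ⟨h3, funext fun s => ?_⟩
    have hs := h.actor_eq_zero_iff hγ0 hγ1 hα hpos hac (show k ≤ K by omega)
    rw [h.actor_step_eq hγ0 hγ1 hα hpos hac hk (hs ω),
      h.actor_step_eq hγ0 hγ1 hα hpos hac hk (hs ω'), h2, h3]

/-- The sample vector takes finitely many values, so every function of an iterate is integrable, and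
independence of the random time from the samples extends to the iterates. -/
theorem factorsThrough (h : IsTTNAC M γ φ μ α β K θ₀ π₀ Pr ℱ Z θ π) (hγ0 : 0 ≤ γ)
    (hγ1 : γ < 1) (hα : 0 < α) (hpos : ∀ s, 0 < M.visitation γ πstar s)
    (hac : ∀ s a, π₀ s a = 0 → πstar s a = 0) {k : ℕ} (hk : k ≤ K) :
    Function.FactorsThrough (fun ω => (θ k ω, π k ω)) fun ω (j : Fin K) => Z j ω := by
  intro ω ω' hω
  obtain ⟨h1, h2⟩ := h.iterates_congr hγ0 hγ1 hα hpos hac hk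
    fun j hj => congr_fun hω ⟨j, by omega⟩
  simp only [h1, h2]

end IsTTNAC

/-! ### Step sizes in powers of K^(-1/4), and the conclusion. -/

theorem natCast_rpow_neg_div_four {K : ℕ} (n : ℕ) :
    (K : ℝ) ^ (-((n : ℝ) / 4)) = ((K : ℝ) ^ (-(1 / 4) : ℝ)) ^ n := by
  rw [← Real.rpow_natCast, ← Real.rpow_mul (Nat.cast_nonneg K)]
  congr 1
  ring

/-- For y ≤ 1 one has min(c, 1) y ≤ min(c, y) ≤ y, so the truncation changes only the constants. -/
theorem actorStep_bounds {γ rbar μφ Cρ : ℝ} (hγ1 : γ < 1) (hrbar : 0 < rbar) (hμφ : 0 < μφ)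
    (hCρ : 0 < Cρ) : ∃ e₁ e₂ : ℝ, 0 < e₁ ∧ 0 ≤ e₂ ∧ ∀ K : ℕ, 0 < K →
      e₁ * ((K : ℝ) ^ (-(1 / 4) : ℝ)) ^ 3 ≤ actorStep γ rbar μφ Cρ K / (1 - γ) ∧
      actorStep γ rbar μφ Cρ K / (1 - γ) ≤ e₂ * ((K : ℝ) ^ (-(1 / 4) : ℝ)) ^ 3 := by
  have hg : 0 < 1 - γ := sub_pos.2 hγ1
  have ha : 0 < (1 - γ) ^ 3 * μφ / √(rbar * Cρ ^ 2) :=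
    div_pos (by positivity) (Real.sqrt_pos.2 (by positivity))
  have hc : 0 < (1 - γ) ^ 2 / (128 * (μφ ^ 2)⁻¹) := by positivity
  set a := (1 - γ) ^ 3 * μφ / √(rbar * Cρ ^ 2)
  set c := (1 - γ) ^ 2 / (128 * (μφ ^ 2)⁻¹)
  refine ⟨a * min c 1 / (1 - γ), a / (1 - γ), div_pos (mul_pos ha (lt_min hc one_pos)) hg,
    by positivity, fun K hK => ?_⟩
  have h3 : (K : ℝ) ^ (-(3 / 4) : ℝ) = ((K : ℝ) ^ (-(1 / 4) : ℝ)) ^ 3 := by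
    exact_mod_cast natCast_rpow_neg_div_four (K := K) 3
  have hx0 : 0 ≤ ((K : ℝ) ^ (-(1 / 4) : ℝ)) ^ 3 := by positivity
  have hx1 : ((K : ℝ) ^ (-(1 / 4) : ℝ)) ^ 3 ≤ 1 :=
    pow_le_one₀ (by positivity)
      (Real.rpow_le_one_of_one_le_of_nonpos (Nat.one_le_cast.2 hK) (by norm_num))
  have heq : actorStep γ rbar μφ Cρ K = a * min c (((K : ℝ) ^ (-(1 / 4) : ℝ)) ^ 3) := by
    rw [actorStep, h3]
  clear_value a c
  rw [heq, div_mul_eq_mul_div, div_mul_eq_mul_div, mul_assoc]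
  generalize ((K : ℝ) ^ (-(1 / 4) : ℝ)) ^ 3 = y at hx0 hx1
  constructor
  · refine div_le_div_of_nonneg_right (mul_le_mul_of_nonneg_left (le_min ?_ ?_) ha.le) hg.le
    · exact (mul_le_of_le_one_right (lt_min hc one_pos).le hx1).trans (min_le_left _ _)
    · exact mul_le_of_le_one_left hx0 (min_le_right _ _)
  · exact div_le_div_of_nonneg_right (mul_le_mul_of_nonneg_left (min_le_right _ _) ha.le) hg.le

theorem criticStep_bounds {γ μφ : ℝ} (hγ1 : γ < 1) (hμφ : 0 < μφ) :
    ∃ c₁ c₂ : ℝ, 0 < c₁ ∧ ∀ K : ℕ, 0 < K →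
      c₁ * ((K : ℝ) ^ (-(1 / 4) : ℝ)) ^ 2 ≤ criticStep γ μφ K ∧
      criticStep γ μφ K ≤ c₂ * ((K : ℝ) ^ (-(1 / 4) : ℝ)) ^ 2 ∧
      criticStep γ μφ K ≤ (1 - γ) * μφ ^ 2 / 8 := by
  have hg : 0 < 1 - γ := sub_pos.2 hγ1
  have ha : 0 < 16 / ((1 - γ) * μφ ^ 2) := by positivity
  have hc : 0 < (1 - γ) * μφ ^ 2 / 8 := by positivity
  set a := 16 / ((1 - γ) * μφ ^ 2)
  set c := (1 - γ) * μφ ^ 2 / 8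
  refine ⟨min c a, a, lt_min hc ha, fun K hK => ?_⟩
  have h2 : (K : ℝ) ^ (-(1 / 2) : ℝ) = ((K : ℝ) ^ (-(1 / 4) : ℝ)) ^ 2 := by
    rw [← natCast_rpow_neg_div_four (K := K) 2]
    norm_num
  have hx0 : 0 ≤ ((K : ℝ) ^ (-(1 / 4) : ℝ)) ^ 2 := by positivity
  have hx1 : ((K : ℝ) ^ (-(1 / 4) : ℝ)) ^ 2 ≤ 1 :=
    pow_le_one₀ (by positivity)
      (Real.rpow_le_one_of_one_le_of_nonpos (Nat.one_le_cast.2 hK) (by norm_num))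
  have heq : criticStep γ μφ K = min c (a * ((K : ℝ) ^ (-(1 / 4) : ℝ)) ^ 2) := by
    rw [criticStep, h2]
  rw [heq]
  generalize ((K : ℝ) ^ (-(1 / 4) : ℝ)) ^ 2 = y at hx0 hx1
  refine ⟨le_min ?_ ?_, min_le_right _ _, min_le_left _ _⟩
  · exact (mul_le_of_le_one_right (lt_min hc ha).le hx1).trans (min_le_left _ _)
  · exact mul_le_mul_of_nonneg_right (min_le_right _ _) hx0

/-- Young's inequality for the square of a sum. -/
theorem sq_norm_add_le_of_pos {E : Type*} [SeminormedAddCommGroup E] {c : ℝ} (hc : 0 < c)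
    (u v : E) : ‖u + v‖ ^ 2 ≤ (1 + c / 2) * ‖u‖ ^ 2 + (1 + 2 / c) * ‖v‖ ^ 2 := by
  have h1 : ‖u + v‖ ^ 2 ≤ (‖u‖ + ‖v‖) ^ 2 := pow_le_pow_left₀ (norm_nonneg _) (norm_add_le u v) 2
  have h2 : 0 ≤ (c / 2 * ‖u‖ - ‖v‖) ^ 2 * (2 / c) := by positivity
  have h3 : (c / 2 * ‖u‖ - ‖v‖) ^ 2 * (2 / c) =
      c / 2 * ‖u‖ ^ 2 - 2 * ‖u‖ * ‖v‖ + 2 / c * ‖v‖ ^ 2 := by field_simp; ring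
  linarith

theorem mainTheorem4 (γ rbar μφ Cρ B : ℝ) (hγ0 : 0 ≤ γ) (hγ1 : γ < 1) (hrbar : 0 < rbar)
    (hμφ : 0 < μφ) (hCρ : 0 < Cρ) :
    ∃ C : ℝ, ∀ (S A : Type*) [Countable S] [MeasurableSpace S] [MeasurableSingletonClass S]
      [Fintype A] [MeasurableSpace A] [MeasurableSingletonClass A] (d : ℕ)
      (M : MDP S A) (φ : S → A → EuclideanSpace ℝ (Fin d))
      (μ : Policy S A → PMF S) (θstar : Policy S A → EuclideanSpace ℝ (Fin d))
      (πstar π₀ : Policy S A) (θ₀ : EuclideanSpace ℝ (Fin d)),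
      -- bounded rewards
      (∀ s a, |M.r s a| ≤ rbar) →
      -- bounded features and exact linear action-value functions
      (∀ s a, ‖φ s a‖ ≤ 1) →
      (∀ π : Policy S A, ∃ θ, ∀ s a, M.qValue γ π s a = linQ φ θ s a) →
      -- `μ π` is the unique stationary distribution, with well-conditioned feature covariance
      (∀ π : Policy S A, M.IsStationary π (μ π) ∧ ∀ ν, M.IsStationary π ν → ν = μ π) →
      (∀ π : Policy S A, (featureCov φ (μ π) π - μφ ^ 2 • 1).PosSemidef) →
      -- `θstar π` solves the inner problem, `πstar` the outer one
      (∀ π : Policy S A, IsMinOn (msbe M γ φ (μ π) π) Set.univ (θstar π)) →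
      IsMinOn (outerLoss M φ θstar) Set.univ πstar →
      -- concentrability
      Concentrability M γ πstar Cρ →
      -- the initial point
      ‖θ₀ - θstar π₀‖ ≤ B →
      klBar (M.visitation γ πstar) πstar π₀ ≤ ENNReal.ofReal B →
      ∀ (K : ℕ), 32 ^ 2 ≤ K →
      ∀ (Ω : Type*) (mΩ : MeasurableSpace Ω) (Pr : Measure Ω) [IsProbabilityMeasure Pr]
        (ℱ : Filtration ℕ mΩ) (Z : ℕ → Ω → S × A × S × A)
        (θ : ℕ → Ω → EuclideanSpace ℝ (Fin d)) (π : ℕ → Ω → Policy S A) (N : Ω → ℕ),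
        IsTTNAC M γ φ μ (actorStep γ rbar μφ Cρ K) (criticStep γ μφ K) K θ₀ π₀ Pr ℱ Z θ π →
        -- `N` is uniform on `{0, …, K - 1}` and independent of the samples
        Measurable N →
        (∀ k < K, Pr (N ⁻¹' {k}) = (K : ℝ≥0∞)⁻¹) →
        IndepFun N (fun ω (k : Fin K) => Z k ω) Pr →
        (Integrable (fun ω => outerLoss M φ θstar (π (N ω) ω) - outerLoss M φ θstar πstar) Pr ∧
          ∫ ω, (outerLoss M φ θstar (π (N ω) ω) - outerLoss M φ θstar πstar) ∂Pr
            ≤ C * (K : ℝ) ^ (-(1 / 4) : ℝ)) ∧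
        (Integrable (fun ω => ‖θ (N ω + 1) ω - θstar (π (N ω) ω)‖ ^ 2) Pr ∧
          ∫ ω, ‖θ (N ω + 1) ω - θstar (π (N ω) ω)‖ ^ 2 ∂Pr
            ≤ C * (K : ℝ) ^ (-(1 / 2) : ℝ)) := by
  have hg : 0 < 1 - γ := sub_pos.2 hγ1
  obtain ⟨e₁, e₂, he₁, he₂, hact⟩ := actorStep_bounds hγ1 hrbar hμφ hCρ
  obtain ⟨c₁, c₂, hc₁, hcrit⟩ := criticStep_bounds hγ1 hμφ
  have hq : 0 < (1 - γ) * μφ ^ 2 := by positivity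
  set q := (1 - γ) * μφ ^ 2 with hqdef
  set R := rbar / (1 - γ) / μφ with hR
  set L := 4 * (rbar / (1 - γ)) / (1 - γ) / μφ with hL
  -- B² + |B| dominates both the initial squared error and the initial divergence. The contraction
  -- rate is λ = βq, at most q²/8 by the cap on β. Everything here is fixed before the decision
  -- process, so `C` is uniform over all of them.
  obtain ⟨C, hC⟩ := two_timescale_rates (B ^ 2 + |B|) (1 - γ) e₁ e₂ (c₁ * q) (q / 8 * q) (c₂ ^ 2)
    (rbar + 2 * R) L R (by positivity) hg he₁ he₂ (by positivity) (by positivity) (by positivity)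
  refine ⟨C, ?_⟩
  intro S A _ _ _ _ _ _ d M φ μ θstar πstar π₀ θ₀ hr hφ hreal hstat hcov hmin _ hconc hθ₀ hkl
    K hK Ω mΩ Pr _ ℱ Z θ π N h hN hunif hind
  have hB : 0 ≤ B := (norm_nonneg _).trans hθ₀
  have hK0 : 0 < K := by omega
  obtain ⟨hη₁, hη₂⟩ := hact K hK0
  obtain ⟨hβ₁, hβ₂, hβ₃⟩ := hcrit K hK0
  set x : ℝ := (K : ℝ) ^ (-(1 / 4) : ℝ) with hx
  have hx0 : 0 < x := Real.rpow_pos_of_pos (Nat.cast_pos.2 hK0) _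
  have hx1 : x ≤ 1 :=
    Real.rpow_le_one_of_one_le_of_nonpos (Nat.one_le_cast.2 hK0) (by norm_num)
  have hx2 : (K : ℝ) ^ (-(1 / 2) : ℝ) = x ^ 2 := by
    rw [hx, ← natCast_rpow_neg_div_four (K := K) 2]
    norm_num
  have hKx : (K : ℝ) * x ^ 4 = 1 := by
    rw [hx, ← natCast_rpow_neg_div_four (K := K) 4]
    norm_num [Real.rpow_neg_one, hK0.ne']
  rw [hx2]
  set α := actorStep γ rbar μφ Cρ K
  set β := criticStep γ μφ K
  set η := α / (1 - γ) with hηdef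
  have hη : 0 < η := lt_of_lt_of_le (by positivity) hη₁
  have hα : 0 < α := by
    rw [hηdef] at hη
    exact (div_pos_iff_of_pos_right hg).1 hη
  have hβ : 0 < β := lt_of_lt_of_le (by positivity) hβ₁
  have : Finite S := M.finite_of_concentrability hγ0 hγ1 hconc
  let _ : Fintype S := Fintype.ofFinite S
  have hpos : ∀ s, 0 < M.visitation γ πstar s := fun s =>
    (M.visitation_ge_of_concentrability hγ0 hγ1 hconc s).1
  have hρ0 : ∀ s, 0 ≤ M.visitation γ πstar s := fun s => (hpos s).le
  have hac := eq_zero_of_klBar_ne_top hpos (hkl.trans_lt ENNReal.ofReal_lt_top).ne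
  have hΦ0 : realKLBar (M.visitation γ πstar) πstar π₀ ≤ B := by
    rwa [klBar_eq_ofReal hρ0 hac, ENNReal.ofReal_le_ofReal_iff hB] at hkl
  have hθ : ∀ p s a, M.qValue γ p s a = linQ φ (θstar p) s a := by
    intro p
    obtain ⟨θq, hθq⟩ := hreal p
    rwa [eq_of_isMinOn_msbe hγ0 hγ1 hμφ hr (hstat p).1 (hcov p) hθq (hmin p)]
  have hθR : ∀ p, ‖θstar p‖ ≤ R := fun p => norm_le_of_abs_linQ_le hμφ (hcov p) fun s a => by
    rw [← hθ]
    exact M.abs_qValue_le hγ0 hγ1 p hr s a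
  have hsupp : ∀ k ≤ K, ∀ ω, ∀ s a, π k ω s a = 0 ↔ π₀ s a = 0 := fun k hk ω =>
    h.actor_eq_zero_iff hγ0 hγ1 hα hpos hac hk ω
  have hack : ∀ k ≤ K, ∀ ω, ∀ s a, π k ω s a = 0 → πstar s a = 0 := fun k hk ω s a h0 =>
    hac s a ((hsupp k hk ω s a).1 h0)
  have hstep : ∀ k < K, ∀ ω s,
      π (k + 1) ω s = (π k ω s).softmax fun a => η * linQ φ (θ (k + 1) ω) s a :=
    fun k hk ω => h.actor_step_eq hγ0 hγ1 hα hpos hac hk (hsupp k hk.le ω)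
  set W : Ω → Fin K → S × A × S × A := fun ω k => Z k ω with hWdef
  have hW : Measurable W := measurable_pi_lambda _ fun k => h.measurable_sample k k.2
  have hfac : ∀ k ≤ K, Function.FactorsThrough (fun ω => (θ k ω, π k ω)) W := fun k hk =>
    h.factorsThrough hγ0 hγ1 hα hpos hac hk
  have hfacθ : ∀ k ≤ K, ∀ ω ω', W ω = W ω' → θ k ω = θ k ω' := fun k hk ω ω' hω =>
    congr_arg Prod.fst (hfac k hk hω)
  have hfacπ : ∀ k ≤ K, ∀ ω ω', W ω = W ω' → π k ω = π k ω' := fun k hk ω ω' hω =>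
    congr_arg Prod.snd (hfac k hk hω)
  have hfE : ∀ k ≤ K, Function.FactorsThrough (fun ω => ‖θ k ω - θstar (π k ω)‖ ^ 2) W :=
    fun k hk ω ω' hω => by simp only [hfacθ k hk ω ω' hω, hfacπ k hk ω ω' hω]
  have hfD : ∀ k < K, Function.FactorsThrough (fun ω => ‖θ (k + 1) ω - θstar (π k ω)‖ ^ 2) W :=
    fun k hk ω ω' hω => by simp only [hfacθ (k + 1) hk ω ω' hω, hfacπ k hk.le ω ω' hω]
  have hfG : ∀ k < K, Function.FactorsThrough
      (fun ω => outerLoss M φ θstar (π k ω) - outerLoss M φ θstar πstar) W :=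
    fun k hk ω ω' hω => by simp only [hfacπ k hk.le ω ω' hω]
  have hfΦ : ∀ k ≤ K, Function.FactorsThrough
      (fun ω => realKLBar (M.visitation γ πstar) πstar (π k ω)) W :=
    fun k hk ω ω' hω => by simp only [hfacπ k hk ω ω' hω]
  have hiE := fun k hk => (hfE k hk).integrable (P := Pr) hW
  have hiD := fun k hk => (hfD k hk).integrable (P := Pr) hW
  have hiG := fun k hk => (hfG k hk).integrable (P := Pr) hW
  have hiΦ := fun k hk => (hfΦ k hk).integrable (P := Pr) hW
  obtain ⟨hI1, hI1e⟩ := integral_uniform_time hW hN hK0 hunif hind hfG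
  obtain ⟨hI2, hI2e⟩ := integral_uniform_time hW hN hK0 hunif hind hfD
  -- The critic is not projected, so its size is controlled by its own error and the bound R on the
  -- targets.
  have hθsq : ∀ k ω, ‖θ (k + 1) ω‖ ^ 2 ≤ 2 * ‖θ (k + 1) ω - θstar (π k ω)‖ ^ 2 + 2 * R ^ 2 := by
    intro k ω
    have i1 : ‖θ (k + 1) ω‖ ≤ ‖θ (k + 1) ω - θstar (π k ω)‖ + R :=
      (norm_le_norm_sub_add _ _).trans (by linarith [hθR (π k ω)])
    have i2 := pow_le_pow_left₀ (norm_nonneg _) i1 2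
    linarith [sq_nonneg (‖θ (k + 1) ω - θstar (π k ω)‖ - R)]
  have key := hC K x η (β * q) β (fun k => ∫ ω, ‖θ k ω - θstar (π k ω)‖ ^ 2 ∂Pr)
    (fun k => ∫ ω, ‖θ (k + 1) ω - θstar (π k ω)‖ ^ 2 ∂Pr)
    (fun k => ∫ ω, realKLBar (M.visitation γ πstar) πstar (π k ω) ∂Pr)
    (fun k => ∫ ω, (outerLoss M φ θstar (π k ω) - outerLoss M φ θstar πstar) ∂Pr)
    hK0 hx0 hx1 hKx hη₁ hη₂ (by nlinarith) (mul_le_mul_of_nonneg_right hβ₃ hq.le)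
    (by
      calc β ^ 2 ≤ (c₂ * x ^ 2) ^ 2 := pow_le_pow_left₀ hβ.le hβ₂ 2
        _ = _ := by ring)
    (fun k => integral_nonneg fun ω => sq_nonneg _) (fun k => integral_nonneg fun ω => sq_nonneg _)
    (by
      simp only [h.init_critic, h.init_actor, integral_const, probReal_univ, one_smul]
      have := pow_le_pow_left₀ (norm_nonneg _) hθ₀ 2
      linarith [abs_nonneg B])
    (by
      simp only [h.init_actor, integral_const, probReal_univ, one_smul]
      linarith [sq_nonneg B, le_abs_self B])
    (integral_nonneg fun ω => realKLBar_nonneg hρ0 (hack K le_rfl ω))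
    ?_ ?_ ?_
  · rw [hI1e, hI2e]
    exact ⟨⟨hI1, key.1⟩, hI2, key.2⟩
  · intro k hk
    have i1 := integral_eq_integral_sum_of_condExp (ℱ.le k)
      (have : Nonempty (EuclideanSpace ℝ (Fin d) × Policy S A) := ⟨(θ₀, π₀)⟩
       (hfac k hk.le).finite_range) (h.measurableSet_preimage hk.le)
      (h.measurable_sample k hk) (q := fun p z => sampleProb M (μ p.2) p.2 z)
      (h.sample_law k hk)
      fun p z => ‖p.1 - β • tdDirection M γ φ p.1 z - θstar p.2‖ ^ 2
    have i2 : ∫ ω, ‖θ (k + 1) ω - θstar (π k ω)‖ ^ 2 ∂Pr =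
        ∫ ω, ‖θ k ω - β • tdDirection M γ φ (θ k ω) (Z k ω) - θstar (π k ω)‖ ^ 2 ∂Pr := by
      simp only [h.critic_step k hk]
    rw [i2, i1, ← integral_const_mul]
    calc _ ≤ ∫ ω, ((1 - β * q) * ‖θ k ω - θstar (π k ω)‖ ^ 2 +
          2 * β ^ 2 * (rbar + 2 * R) ^ 2) ∂Pr := by
          refine integral_mono ?_ (((hiE k hk.le).const_mul _).add (integrable_const _))
            fun ω => sum_sampleProb_sq_norm_critic_le hγ0 hγ1 hr hφ (hstat _).1 (hcov _)
              (hθ _) (hθR _) hβ.le hβ₃ _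
          refine Function.FactorsThrough.integrable hW fun ω ω' hω => ?_
          simp only [hfacθ k hk.le ω ω' hω, hfacπ k hk.le ω ω' hω]
      _ = _ := by
          rw [integral_add ((hiE k hk.le).const_mul _) (integrable_const _), integral_const,
            probReal_univ, one_smul]
  · intro k hk
    have hβq : 0 < β * q := mul_pos hβ hq
    have i1 : ∀ ω, ‖θ (k + 1) ω - θstar (π (k + 1) ω)‖ ^ 2 ≤
        ((1 + β * q / 2) + (1 + 2 / (β * q)) * (L ^ 2 * η ^ 2 * 2)) *
          ‖θ (k + 1) ω - θstar (π k ω)‖ ^ 2 +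
        (1 + 2 / (β * q)) * (L ^ 2 * η ^ 2 * (2 * R ^ 2)) := by
      intro ω
      have j1 := sq_norm_add_le_of_pos hβq (θ (k + 1) ω - θstar (π k ω))
        (θstar (π k ω) - θstar (π (k + 1) ω))
      rw [sub_add_sub_cancel] at j1
      have j2 : ‖θstar (π k ω) - θstar (π (k + 1) ω)‖ ≤ L * η * ‖θ (k + 1) ω‖ := by
        rw [norm_sub_rev]
        refine (norm_thetaStar_sub_le hγ0 hγ1 hμφ hη.le hr hφ hθ (hcov (π k ω)) _
          (hstep k hk ω)).trans (le_of_eq ?_)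
        rw [hL]
        ring
      have j3 : ‖θstar (π k ω) - θstar (π (k + 1) ω)‖ ^ 2 ≤
          L ^ 2 * η ^ 2 * (2 * ‖θ (k + 1) ω - θstar (π k ω)‖ ^ 2 + 2 * R ^ 2) := by
        calc _ ≤ (L * η * ‖θ (k + 1) ω‖) ^ 2 := pow_le_pow_left₀ (norm_nonneg _) j2 2
          _ = L ^ 2 * η ^ 2 * ‖θ (k + 1) ω‖ ^ 2 := by ring
          _ ≤ _ := mul_le_mul_of_nonneg_left (hθsq k ω) (by positivity)
      have j4 := mul_le_mul_of_nonneg_left j3 (by positivity : 0 ≤ 1 + 2 / (β * q))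
      linarith
    have i2 := integral_mono (hiE (k + 1) hk)
      (((hiD k hk).const_mul _).add (integrable_const _)) i1
    rw [integral_add' ((hiD k hk).const_mul _) (integrable_const _), integral_const_mul,
      integral_const, probReal_univ, one_smul] at i2
    refine i2.trans (le_of_eq ?_)
    ring
  · intro k hk
    have i1 : ∀ ω, η * ((1 - γ) * (outerLoss M φ θstar (π k ω) - outerLoss M φ θstar πstar)) ≤
        realKLBar (M.visitation γ πstar) πstar (π k ω) -
          realKLBar (M.visitation γ πstar) πstar (π (k + 1) ω) +
          ((4 * η ^ 2 + η / x) * ‖θ (k + 1) ω - θstar (π k ω)‖ ^ 2 +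
            (4 * η ^ 2 * R ^ 2 + η * x)) := by
      intro ω
      have j1 := outerLoss_gap_le hγ0 hγ1 hη.le hr hφ hθ (hack k hk.le ω) _ (hstep k hk ω)
      have j2 := mul_le_mul_of_nonneg_left (hθsq k ω) (by positivity : 0 ≤ 2 * η ^ 2)
      set D := ‖θ (k + 1) ω - θstar (π k ω)‖
      -- The gap bound is linear in the critic error while the recursion controls its square; the
      -- weight x balances the two, since D² averages to O(x²).
      have j3 : 2 * D ≤ x + D ^ 2 / x := by
        rw [← sub_nonneg]
        have : x + D ^ 2 / x - 2 * D = (x - D) ^ 2 / x := by field_simp; ring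
        rw [this]
        positivity
      have j4 := mul_le_mul_of_nonneg_left j3 hη.le
      have j5 : η / x * D ^ 2 = η * (D ^ 2 / x) := by ring
      rw [add_mul, j5]
      linarith
    have hi3 := ((hiD k hk).const_mul (4 * η ^ 2 + η / x)).add
      (integrable_const (μ := Pr) (4 * η ^ 2 * R ^ 2 + η * x))
    have i2 := integral_mono (((hiG k hk).const_mul (1 - γ)).const_mul η)
      (((hiΦ k hk.le).sub (hiΦ (k + 1) hk)).add hi3) i1
    rw [integral_add' ((hiΦ k hk.le).sub (hiΦ (k + 1) hk)) hi3,
      integral_sub' (hiΦ k hk.le) (hiΦ (k + 1) hk),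
      integral_add' ((hiD k hk).const_mul _) (integrable_const _), integral_const_mul,
      integral_const_mul, integral_const_mul, integral_const, probReal_univ, one_smul] at i2
    refine i2.trans (le_of_eq ?_)
    ring
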